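/- Let $R$ be an associative ring with $1$, not necessarily commutative; "module" means unital right $R$-module. A module $M$ is flat if $M\otimes_R -$ preserves monomorphisms of left $R$-modules, and Mittag--Leffler if for every family $(Q_i)_{i\in I}$ of left $R$-modules the canonical map $M\otimes_R\prod_{i\in I} Q_i\to\prod_{i\in I}(M\otimes_R Q_i)$ is injective. Let $\mathcal D$ be the class of all flat Mittag--Leffler modules. For an infinite cardinal $\kappa$, a module is $<\kappa$-presented if it is isomorphic to $F/K$ with $F$ free of rank $<\kappa$ and $K$ generated by fewer than $\kappa$ elements. A class $\mathcal A$ of modules is deconstructible if there is an infinite cardinal $\kappa$ such that each $M\in\mathcal A$ has an increasing chain of submodules $(M_\alpha\mid\alpha\le\lambda)$, indexed by the ordinals up to some ordinal $\lambda$, with $M_0=0$, $M_\lambda=M$, $M_\alpha=\bigcup_{\beta<\alpha}M_\beta$ for all limit ordinals $\alpha\le\lambda$, and $M_{\alpha+1}/M_\alpha$ isomorphic to a $<\kappa$-presented module in $\mathcal A$ for all $\alpha<\lambda$. The ring $R$ is right perfect if every (right) module has a projective cover. A cotorsion pair is a pair $(\mathcal A,\mathcal B)$ of classes of modules with $\mathcal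 A=\{A\mid \mathrm{Ext}^1_R(A,B)=0\ \forall B\in\mathcal B\}$ and $\mathcal B=\{B\mid \mathrm{Ext}^1_R(A,B)=0\ \forall A\in\mathcal A\}$; it is generated by a set if there is a set $\mathcal S$ of modules with $\mathcal B=\{B\mid \mathrm{Ext}^1_R(S,B)=0\ \forall S\in\mathcal S\}$. Then $\mathcal D$ is deconstructible if and only if $R$ is right perfect. Moreover, if $R$ is not right perfect, then there is no class $\mathcal B$ such that $(\mathcal D,\mathcal B)$ is a cotorsion pair generated by a set; in particular, $\mathcal D$ is not the left-hand class of a small cotorsion pair in the sense of Hovey. -/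

import Mathlib

/-! Throughout, `R` is an associative ring with `1`, not necessarily commutative. Right `R`-modules
are modules over the opposite ring `Rᵐᵒᵖ`, with `m r` written as `MulOpposite.op r • m`. Classes of
right modules are properties of objects of `ModuleCat Rᵐᵒᵖ`. -/

open scoped TensorProduct
open CategoryTheory

universe u

namespace FlatML

section Tensor

variable (R : Type u) [Ring R]

/-- The subgroup of `M ⊗_ℤ Q` generated by the elements `(m r) ⊗ q - m ⊗ (r q)`. -/
def balancing (M : Type u) [AddCommGroup M] [Module Rᵐᵒᵖ M]
    (Q : Type u) [AddCommGroup Q] [Module R Q] : AddSubgroup (M ⊗[ℤ] Q) :=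
  AddSubgroup.closure
    {t | ∃ (m : M) (r : R) (q : Q), t = (MulOpposite.op r • m) ⊗ₜ[ℤ] q - m ⊗ₜ[ℤ] (r • q)}

/-- The tensor product `M ⊗_R Q` of a right `R`-module `M` and a left `R`-module `Q`
(an abelian group). -/
abbrev Tensor (M : Type u) [AddCommGroup M] [Module Rᵐᵒᵖ M]
    (Q : Type u) [AddCommGroup Q] [Module R Q] : Type u :=
  (M ⊗[ℤ] Q) ⧸ balancing R M Q

variable (M : Type u) [AddCommGroup M] [Module Rᵐᵒᵖ M]

lemma balancing_le_comap {Q Q' : Type u} [AddCommGroup Q] [Module R Q]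
    [AddCommGroup Q'] [Module R Q'] (f : Q →ₗ[R] Q') :
    balancing R M Q ≤ (balancing R M Q').comap
      (TensorProduct.map (LinearMap.id (R := ℤ) (M := M))
        f.toAddMonoidHom.toIntLinearMap).toAddMonoidHom := by
  refine (AddSubgroup.closure_le _).2 ?_
  rintro _ ⟨m, r, q, rfl⟩
  refine AddSubgroup.subset_closure ⟨m, r, f q, ?_⟩
  simp

/-- The homomorphism `M ⊗_R f : M ⊗_R Q → M ⊗_R Q'`, `m ⊗ q ↦ m ⊗ f q`, induced by an `R`-linear
map `f : Q → Q'` of left modules. -/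
def Tensor.map {Q Q' : Type u} [AddCommGroup Q] [Module R Q]
    [AddCommGroup Q'] [Module R Q'] (f : Q →ₗ[R] Q') : Tensor R M Q →+ Tensor R M Q' :=
  QuotientAddGroup.map (balancing R M Q) (balancing R M Q')
    (TensorProduct.map (LinearMap.id (R := ℤ) (M := M))
      f.toAddMonoidHom.toIntLinearMap).toAddMonoidHom (balancing_le_comap R M f)

/-- The canonical homomorphism `ρ : M ⊗_R ∏ i, Q i → ∏ i, M ⊗_R Q i`,
`m ⊗ (q i)_i ↦ (m ⊗ q i)_i`. -/
def rho {ι : Type u} (Q : ι → Type u) [∀ i, AddCommGroup (Q i)] [∀ i, Module R (Q i)] :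
    Tensor R M ((i : ι) → Q i) →+ ((i : ι) → Tensor R M (Q i)) :=
  AddMonoidHom.mk' (fun t i => Tensor.map R M (LinearMap.proj (R := R) (φ := Q) i) t)
    (fun a b => funext fun i => map_add _ a b)

/-- The right `R`-module `M` is flat: `M ⊗_R -` preserves injectivity. -/
def IsFlat : Prop :=
  ∀ (Q Q' : Type u) [AddCommGroup Q] [Module R Q] [AddCommGroup Q'] [Module R Q']
    (f : Q →ₗ[R] Q'), Function.Injective f → Function.Injective (Tensor.map R M f)

/-- The right `R`-module `M` is Mittag-Leffler: `ρ` is injective for every family of left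
`R`-modules. -/
def IsMittagLeffler : Prop :=
  ∀ (ι : Type u) (Q : ι → Type u) [∀ i, AddCommGroup (Q i)] [∀ i, Module R (Q i)],
    Function.Injective (rho R M Q)

end Tensor

/-- The class `𝒟` of all flat Mittag-Leffler right `R`-modules. -/
def flatMittagLeffler (R : Type u) [Ring R] : ObjectProperty (ModuleCat.{u} Rᵐᵒᵖ) :=
  fun M => IsFlat R M ∧ IsMittagLeffler R M

section Perfect

variable (S : Type u) [Ring S]

/-- A surjective linear map with superfluous kernel from a projective module. -/
def IsProjectiveCover {P M : Type u} [AddCommGroup P] [Module S P] [AddCommGroup M] [Module S M]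
    (f : P →ₗ[S] M) : Prop :=
  Module.Projective S P ∧ Function.Surjective f ∧
    ∀ N : Submodule S P, N ⊔ LinearMap.ker f = ⊤ → N = ⊤

/-- A ring `R` is right perfect if every right `R`-module has a projective cover. -/
def IsRightPerfect (R : Type u) [Ring R] : Prop :=
  ∀ (M : Type u) [AddCommGroup M] [Module Rᵐᵒᵖ M],
    ∃ (P : ModuleCat.{u} Rᵐᵒᵖ) (f : P →ₗ[Rᵐᵒᵖ] M), IsProjectiveCover Rᵐᵒᵖ f

end Perfect

section Deconstructible

variable {S : Type u} [Ring S]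

/-- `M` has a presentation `0 → K → F → M → 0` with `F` free of rank `< κ` and `K` generated by a
set of cardinality `< κ`. -/
def IsLTPresented (κ : Cardinal.{u}) (M : Type u) [AddCommGroup M] [Module S M] : Prop :=
  ∃ (X : Type u) (f : (X →₀ S) →ₗ[S] M) (Y : Set (X →₀ S)),
    Cardinal.mk X < κ ∧ Function.Surjective f ∧
      Cardinal.mk Y < κ ∧ Submodule.span S Y = LinearMap.ker f

/-- The chain `(F α | α ≤ l)` is a filtration of `M` (the values of `F` above `l` are
irrelevant). -/
structure IsFiltration {M : Type u} [AddCommGroup M] [Module S M]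
    (l : Ordinal.{u}) (F : Ordinal.{u} → Submodule S M) : Prop where
  zero : F 0 = ⊥
  top : F l = ⊤
  mono : ∀ α β, α ≤ β → β ≤ l → F α ≤ F β
  limit : ∀ α, α ≤ l → Order.IsSuccLimit α → (F α : Set M) = ⋃ β < α, (F β : Set M)

/-- `M` is a transfinite extension of modules in the class `𝒜`. -/
def IsTransfiniteExtension (𝒜 : ObjectProperty (ModuleCat.{u} S))
    (M : Type u) [AddCommGroup M] [Module S M] : Prop :=
  ∃ (l : Ordinal.{u}) (F : Ordinal.{u} → Submodule S M), IsFiltration l F ∧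
    ∀ α < l, ∃ A : ModuleCat.{u} S, 𝒜 A ∧
      Nonempty ((F (Order.succ α) ⧸ (F α).submoduleOf (F (Order.succ α))) ≃ₗ[S] A)

/-- The class `𝒜^{< κ}` of all `< κ`-presented modules in `𝒜`. -/
def ltPresented (𝒜 : ObjectProperty (ModuleCat.{u} S)) (κ : Cardinal.{u}) :
    ObjectProperty (ModuleCat.{u} S) :=
  fun M => 𝒜 M ∧ IsLTPresented (S := S) κ M

/-- `𝒜` is deconstructible: for some infinite cardinal `κ`, each module in `𝒜` is a transfinite
extension of `< κ`-presented modules in `𝒜`. -/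
def IsDeconstructible (𝒜 : ObjectProperty (ModuleCat.{u} S)) : Prop :=
  ∃ κ : Cardinal.{u}, Cardinal.aleph0 ≤ κ ∧
    ∀ M : ModuleCat.{u} S, 𝒜 M → IsTransfiniteExtension (ltPresented 𝒜 κ) M

end Deconstructible

section Cotorsion

variable {S : Type u} [Ring S]

/-- `𝒞^⊥`, the class of all `B` with `Ext¹(C, B) = 0` for all `C` in `𝒞`. -/
def rightPerp (𝒞 : ObjectProperty (ModuleCat.{u} S)) : ObjectProperty (ModuleCat.{u} S) :=
  fun B => ∀ C, 𝒞 C → Subsingleton (Abelian.Ext.{u} C B 1)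

/-- `^⊥𝒞`, the class of all `A` with `Ext¹(A, C) = 0` for all `C` in `𝒞`. -/
def leftPerp (𝒞 : ObjectProperty (ModuleCat.{u} S)) : ObjectProperty (ModuleCat.{u} S) :=
  fun A => ∀ C, 𝒞 C → Subsingleton (Abelian.Ext.{u} A C 1)

/-- `(𝒜, ℬ)` is a cotorsion pair. -/
def IsCotorsionPair (𝒜 ℬ : ObjectProperty (ModuleCat.{u} S)) : Prop :=
  𝒜 = leftPerp ℬ ∧ rightPerp 𝒜 = ℬ

/-- The class `ℬ` is `𝒮^⊥` for a set (as opposed to a proper class) `𝒮` of modules, given as a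
family indexed by a type in `Type u`. For a cotorsion pair `(𝒜, ℬ)`, this says that the pair is
generated by the set `𝒮`. -/
def IsPerpOfSet (ℬ : ObjectProperty (ModuleCat.{u} S)) : Prop :=
  ∃ (ι : Type u) (G : ι → ModuleCat.{u} S), ℬ = rightPerp (fun M => ∃ i, M = G i)

end Cotorsion

end FlatML

/-! Flat Mittag-Leffler modules are handled through one condition, `HasContents`: in M^(X) = M ⊗
R^(X), an element lying in the images of M ⊗ N for all N in a family of left submodules lies in the
image of M ⊗ ⋂ N. For the whole module this is equivalent to being flat and Mittag-Leffler
(`flatMittagLeffler_iff`), and it passes to transfinite extensions (`IsFiltration.hasContents`).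

The obstruction is the Bass module B, the direct limit of R → R → ⋯ along left multiplications by a
0, a 1, …. If B has contents, the left ideals R a(n-1)⋯a(0) become stationary
(`isStationary_of_hasContents`). If this holds for every sequence a, then R has the descending chain
condition on principal left ideals, R/J is semisimple and J is T-nilpotent, and Bass's argument
yields projective covers (`isRightPerfect_of_isStationary`). Both negative statements thus reduce to
stationarity for each a.

The bridge from B to flat Mittag-Leffler modules is the tree module L. For a set K let T be the tree
of finite sequences in K, whose branches are the maps ℕ → K. There is an exact sequence 0 → R^(T) →
L → B^(branches) → 0 with L locally projective, hence flat Mittag-Leffler. For arbitrarily large K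
there are at least 2^|K| branches but only |K| nodes (`exists_large_type`), and this gap is used
twice.

Cotorsion pairs: if Ext¹(L, N) = 0 for all these L, then Ext¹(B^(branches), N) is a quotient of
Hom(R^(T), N), too small to hold the 2^|branches| classes that a nonzero class in Ext¹(B, N) would
create. So B lies in every class of the form ^⊥ℬ that contains all tree modules
(`subsingleton_ext_bass`).

Deconstructibility: by the Hill lemma a small submodule P of L contains all nodes and has L/P flat
Mittag-Leffler. Some branch is invisible to P, so L/P maps to B along it with an element of
unbounded divisibility above the first generator; this is enough for stationarity.

Conversely, over a right perfect ring a flat Mittag-Leffler module has a projective cover, flatness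
makes the cover an isomorphism, and Kaplansky's theorem filters projective modules by countably
presented projective ones. -/

namespace FlatML

/-! ### Contents in M^(X) and compatibility with intersections -/

section Content

variable {R : Type u} [Ring R] {M : Type u} [AddCommGroup M] [Module Rᵐᵒᵖ M]
  {M' : Type u} [AddCommGroup M'] [Module Rᵐᵒᵖ M'] {X Y Z : Type u}

/-- The element `y ⊗ s` of `M ⊗ R^(X) = M^(X)`: the family `x ↦ y (s x)`. -/
noncomputable def act (y : M) (s : X →₀ R) : X →₀ M :=
  s.mapRange (fun r => MulOpposite.op r • y) (by simp)

@[simp] lemma act_apply (y : M) (s : X →₀ R) (x : X) : act y s x = MulOpposite.op (s x) • y := rfl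

lemma act_add (y : M) (s t : X →₀ R) : act y (s + t) = act y s + act y t := by
  ext x; simp [add_smul]

lemma add_act (y z : M) (s : X →₀ R) : act (y + z) s = act y s + act z s := by
  ext x; simp

lemma act_sub (y : M) (s t : X →₀ R) : act y (s - t) = act y s - act y t := by
  ext x; simp [sub_smul]

@[simp] lemma act_zero (y : M) : act y (0 : X →₀ R) = 0 := by
  ext x; simp

lemma op_smul_act (r : R) (y : M) (s : X →₀ R) :
    act (MulOpposite.op r • y) s = act y (r • s) := by
  ext x; simp [mul_smul]

lemma act_single (y : M) (x : X) (r : R) :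
    act y (Finsupp.single x r) = Finsupp.single x (MulOpposite.op r • y) := by
  simp [act]

/-- The map `act` as a biadditive homomorphism. -/
noncomputable def actHom : M →+ (X →₀ R) →+ (X →₀ M) :=
  AddMonoidHom.mk' (fun y => AddMonoidHom.mk' (act y) (act_add y))
    (fun y z => AddMonoidHom.ext fun s => add_act y z s)

@[simp] lemma actHom_apply (y : M) (s : X →₀ R) : actHom y s = act y s := rfl

/-- The image of `G ⊗ N` in `M^(X)`, for `G ≤ M` and a left submodule `N` of `R^(X)`. -/
noncomputable def spanAct (G : Submodule Rᵐᵒᵖ M) (N : Submodule R (X →₀ R)) :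
    AddSubgroup (X →₀ M) :=
  AddSubgroup.closure {t | ∃ y ∈ G, ∃ s ∈ N, t = act y s}

lemma act_mem {G : Submodule Rᵐᵒᵖ M} {N : Submodule R (X →₀ R)} {y : M} {s : X →₀ R}
    (hy : y ∈ G) (hs : s ∈ N) : act y s ∈ spanAct G N :=
  AddSubgroup.subset_closure ⟨y, hy, s, hs, rfl⟩

lemma spanAct_le {G : Submodule Rᵐᵒᵖ M} {N : Submodule R (X →₀ R)} {A : AddSubgroup (X →₀ M)}
    (h : ∀ y ∈ G, ∀ s ∈ N, act y s ∈ A) : spanAct G N ≤ A :=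
  (AddSubgroup.closure_le _).2 (by rintro _ ⟨y, hy, s, hs, rfl⟩; exact h y hy s hs)

lemma spanAct_mono {G G' : Submodule Rᵐᵒᵖ M} {N N' : Submodule R (X →₀ R)} (hG : G ≤ G')
    (hN : N ≤ N') : spanAct G N ≤ spanAct G' N' :=
  spanAct_le fun _ hy _ hs => act_mem (hG hy) (hN hs)

lemma apply_mem_of_mem_spanAct {G : Submodule Rᵐᵒᵖ M} {N : Submodule R (X →₀ R)} {m : X →₀ M}
    (hm : m ∈ spanAct G N) (x : X) : m x ∈ G := by
  induction hm using AddSubgroup.closure_induction with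
  | mem t ht => obtain ⟨y, hy, s, -, rfl⟩ := ht; exact G.smul_mem _ hy
  | zero => simp
  | add a b _ _ ha hb => exact G.add_mem ha hb
  | neg a _ ha => exact G.neg_mem ha

lemma mem_spanAct_top {G : Submodule Rᵐᵒᵖ M} {m : X →₀ M} :
    m ∈ spanAct G (⊤ : Submodule R (X →₀ R)) ↔ ∀ x, m x ∈ G := by
  refine ⟨fun h => apply_mem_of_mem_spanAct h, fun h => ?_⟩
  rw [← m.sum_single]
  refine AddSubgroup.sum_mem _ fun x _ => ?_
  have : Finsupp.single x (m x) = act (m x) (Finsupp.single x (1 : R)) := by simp [act_single]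
  rw [this]
  exact act_mem (h x) trivial

lemma mem_top_spanAct_top (m : X →₀ M) :
    m ∈ spanAct (⊤ : Submodule Rᵐᵒᵖ M) (⊤ : Submodule R (X →₀ R)) :=
  mem_spanAct_top.2 fun _ => trivial

/-- The homomorphism `M ⊗ φ : M^(X) → M^(Y)` induced by a map `φ : R^(X) → R^(Y)` of left
modules. -/
noncomputable def extend (M : Type u) [AddCommGroup M] [Module Rᵐᵒᵖ M]
    (φ : (X →₀ R) →ₗ[R] (Y →₀ R)) : (X →₀ M) →+ (Y →₀ M) :=
  Finsupp.liftAddHom fun x => actHom.flip (φ (Finsupp.single x 1))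

lemma extend_single (φ : (X →₀ R) →ₗ[R] (Y →₀ R)) (x : X) (y : M) :
    extend M φ (Finsupp.single x y) = act y (φ (Finsupp.single x 1)) := by
  simp [extend]

lemma extend_act (φ : (X →₀ R) →ₗ[R] (Y →₀ R)) (y : M) (s : X →₀ R) :
    extend M φ (act y s) = act y (φ s) := by
  induction s using Finsupp.induction_linear with
  | zero => simp
  | add s t hs ht => rw [act_add, map_add, hs, ht, map_add, act_add]
  | single x r =>
    rw [act_single, extend_single, op_smul_act, ← map_smul, Finsupp.smul_single, smul_eq_mul,
      mul_one]

variable (R) in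
lemma addHom_ext_act {A : Type*} [AddCommGroup A] {f g : (X →₀ M) →+ A}
    (h : ∀ (y : M) (s : X →₀ R), f (act y s) = g (act y s)) : f = g := by
  refine Finsupp.addHom_ext fun x y => ?_
  simpa [act_single] using h y (Finsupp.single x 1)

lemma extend_extend (φ : (X →₀ R) →ₗ[R] (Y →₀ R)) (ψ : (Y →₀ R) →ₗ[R] (Z →₀ R)) (m : X →₀ M) :
    extend M ψ (extend M φ m) = extend M (ψ ∘ₗ φ) m :=
  DFunLike.congr_fun (f := (extend M ψ).comp (extend M φ)) (g := extend M (ψ ∘ₗ φ))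
    (addHom_ext_act R fun y s => by simp [extend_act]) m

lemma extend_add (φ ψ : (X →₀ R) →ₗ[R] (Y →₀ R)) (m : X →₀ M) :
    extend M (φ + ψ) m = extend M φ m + extend M ψ m :=
  DFunLike.congr_fun (f := extend M (φ + ψ)) (g := extend M φ + extend M ψ)
    (addHom_ext_act R fun y s => by simp [extend_act, act_add]) m

lemma extend_id (m : X →₀ M) : extend M (LinearMap.id (R := R) (M := X →₀ R)) m = m :=
  DFunLike.congr_fun (f := extend M (LinearMap.id (R := R) (M := X →₀ R)))
    (g := AddMonoidHom.id _) (addHom_ext_act R fun y s => by simp [extend_act]) m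

lemma extend_mem {G : Submodule Rᵐᵒᵖ M} {N : Submodule R (X →₀ R)}
    (φ : (X →₀ R) →ₗ[R] (Y →₀ R)) {m : X →₀ M} (hm : m ∈ spanAct G N) :
    extend M φ m ∈ spanAct G (N.map φ) :=
  spanAct_le (A := (spanAct G (N.map φ)).comap (extend M φ)) (fun y hy s hs => by
    simpa [extend_act] using act_mem hy (Submodule.mem_map_of_mem hs)) hm

/-- `mapRange` of a linear map as an additive homomorphism. -/
noncomputable def mapCoeff (p : M →ₗ[Rᵐᵒᵖ] M') : (X →₀ M) →+ (X →₀ M') :=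
  Finsupp.mapRange.addMonoidHom p.toAddMonoidHom

@[simp] lemma mapCoeff_apply (p : M →ₗ[Rᵐᵒᵖ] M') (m : X →₀ M) (x : X) :
    mapCoeff p m x = p (m x) := rfl

lemma mapCoeff_act (p : M →ₗ[Rᵐᵒᵖ] M') (y : M) (s : X →₀ R) :
    mapCoeff p (act y s) = act (p y) s := by
  ext x; simp

lemma mapCoeff_mem {G : Submodule Rᵐᵒᵖ M} {N : Submodule R (X →₀ R)} (p : M →ₗ[Rᵐᵒᵖ] M')
    {m : X →₀ M} (hm : m ∈ spanAct G N) : mapCoeff p m ∈ spanAct (G.map p) N :=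
  spanAct_le (A := (spanAct (G.map p) N).comap (mapCoeff p)) (fun y hy s hs => by
    simpa [mapCoeff_act] using act_mem (Submodule.mem_map_of_mem hy) hs) hm

lemma mapCoeff_extend (p : M →ₗ[Rᵐᵒᵖ] M') (φ : (X →₀ R) →ₗ[R] (Y →₀ R)) (m : X →₀ M) :
    mapCoeff p (extend M φ m) = extend M' φ (mapCoeff p m) :=
  DFunLike.congr_fun (f := (mapCoeff p).comp (extend M φ))
    (g := (extend M' φ).comp (mapCoeff p))
    (addHom_ext_act R fun y s => by simp [extend_act, mapCoeff_act]) m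

/-- The map from the free left module on the elements of `N` to `R^(X)`. -/
noncomputable def relMap (N : Submodule R (X →₀ R)) : (N →₀ R) →ₗ[R] (X →₀ R) :=
  Finsupp.linearCombination R (Subtype.val : N → (X →₀ R))

lemma range_relMap (N : Submodule R (X →₀ R)) : LinearMap.range (relMap N) = N := by
  rw [relMap, Finsupp.range_linearCombination]; simp

lemma exists_extend_relMap {G : Submodule Rᵐᵒᵖ M} {N : Submodule R (X →₀ R)} {m : X →₀ M}
    (hm : m ∈ spanAct G N) : ∃ z : N →₀ M, (∀ n, z n ∈ G) ∧ extend M (relMap N) z = m := by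
  have key : spanAct G N ≤ (spanAct G (⊤ : Submodule R (N →₀ R))).map (extend M (relMap N)) := by
    refine spanAct_le fun y hy s hs => ⟨act y (Finsupp.single ⟨s, hs⟩ 1), act_mem hy trivial, ?_⟩
    rw [extend_act]; simp [relMap]
  obtain ⟨z, hz, rfl⟩ := key hm
  exact ⟨z, mem_spanAct_top.1 hz, rfl⟩

/-- For each family of left submodules of a free module, `G ⊗ -` commutes with its intersection;
equivalently, each finite sequence of elements of `G` has a least content submodule. -/
def HasContents (G : Submodule Rᵐᵒᵖ M) : Prop :=
  ∀ (X : Type u) (𝒩 : Set (Submodule R (X →₀ R))) (m : X →₀ M), (∀ x, m x ∈ G) →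
    (∀ N ∈ 𝒩, m ∈ spanAct G N) → m ∈ spanAct G (sInf 𝒩)

/-- Flatness from a single intersection: if φ kills m, the copy of m in M^(X ⊕ Y) lies both over
R^(X) and over the graph of φ, and these two submodules meet in the copy of ker φ. -/
lemma HasContents.mem_ker {G : Submodule Rᵐᵒᵖ M} (hG : HasContents (R := R) G)
    (φ : (X →₀ R) →ₗ[R] (Y →₀ R)) {m : X →₀ M} (hm : ∀ x, m x ∈ G) (h : extend M φ m = 0) :
    m ∈ spanAct G (LinearMap.ker φ) := by
  obtain ⟨ι, κ, ρ, σ, hρι, hρκ, hσι, hσκ⟩ : ∃ (ι : (X →₀ R) →ₗ[R] (X ⊕ Y →₀ R))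
      (κ : (Y →₀ R) →ₗ[R] (X ⊕ Y →₀ R)) (ρ : (X ⊕ Y →₀ R) →ₗ[R] (X →₀ R))
      (σ : (X ⊕ Y →₀ R) →ₗ[R] (Y →₀ R)), (∀ s, ρ (ι s) = s) ∧ (∀ s, ρ (κ s) = 0) ∧
        (∀ s, σ (ι s) = 0) ∧ (∀ s, σ (κ s) = s) := by
    let e := Finsupp.sumFinsuppLEquivProdFinsupp (α := X) (β := Y) (M := R) R
    exact ⟨e.symm.toLinearMap ∘ₗ LinearMap.inl R _ _, e.symm.toLinearMap ∘ₗ LinearMap.inr R _ _,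
      LinearMap.fst R _ _ ∘ₗ e.toLinearMap, LinearMap.snd R _ _ ∘ₗ e.toLinearMap,
      fun s => by simp, fun s => by simp, fun s => by simp, fun s => by simp⟩
  have hγ : extend M (ι + κ ∘ₗ φ) m = extend M ι m := by
    rw [extend_add, ← extend_extend, h, map_zero, add_zero]
  have hm' := mem_spanAct_top (R := R).2 hm
  have h1 : extend M ι m ∈ spanAct G (LinearMap.range ι) := by
    rw [← Submodule.map_top]; exact extend_mem ι hm'
  have h2 : extend M ι m ∈ spanAct G (LinearMap.range (ι + κ ∘ₗ φ)) := by
    rw [← hγ, ← Submodule.map_top]; exact extend_mem _ hm'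
  have h3 := hG _ {LinearMap.range ι, LinearMap.range (ι + κ ∘ₗ φ)} _
    (apply_mem_of_mem_spanAct h1) (by rintro N (rfl | rfl) <;> assumption)
  have h4 := extend_mem ρ h3
  rw [extend_extend, show ρ ∘ₗ ι = LinearMap.id from LinearMap.ext hρι, extend_id] at h4
  refine spanAct_mono le_rfl ?_ h4
  rintro _ ⟨t, ht, rfl⟩
  rw [sInf_pair] at ht
  obtain ⟨⟨a, rfl⟩, ⟨b, hb⟩⟩ := ht
  rw [LinearMap.add_apply, LinearMap.comp_apply] at hb
  have e1 := congrArg ρ hb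
  have e2 := congrArg σ hb
  rw [map_add, hρι, hρκ, hρι, add_zero] at e1
  rw [map_add, hσι, hσκ, hσι, zero_add] at e2
  rw [LinearMap.mem_ker, hρι, ← e1, e2]

end Content

end FlatML

namespace FlatML

/-! ### Flat Mittag-Leffler is equivalent to having contents -/

section TensorBridge

variable {R : Type u} [Ring R] {M : Type u} [AddCommGroup M] [Module Rᵐᵒᵖ M]
  {Q Q' : Type u} [AddCommGroup Q] [Module R Q] [AddCommGroup Q'] [Module R Q'] {X : Type u}

/-- The homomorphism `M^(X) → M ⊗_R Q`, `m ↦ ∑ m x ⊗ g x`. -/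
noncomputable def tmulHom (M : Type u) [AddCommGroup M] [Module Rᵐᵒᵖ M] (g : X → Q) :
    (X →₀ M) →+ Tensor R M Q :=
  Finsupp.liftAddHom fun x => (QuotientAddGroup.mk' (balancing R M Q)).comp
    ((TensorProduct.mk ℤ M Q).flip (g x)).toAddMonoidHom

lemma tmulHom_single (g : X → Q) (x : X) (y : M) :
    tmulHom (R := R) M g (Finsupp.single x y) =
      QuotientAddGroup.mk' (balancing R M Q) (y ⊗ₜ[ℤ] g x) := by
  simp [tmulHom]

lemma mk_op_smul_tmul (r : R) (y : M) (q : Q) :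
    QuotientAddGroup.mk' (balancing R M Q) ((MulOpposite.op r • y) ⊗ₜ[ℤ] q) =
      QuotientAddGroup.mk' (balancing R M Q) (y ⊗ₜ[ℤ] (r • q)) := by
  rw [← sub_eq_zero, ← map_sub]
  exact (QuotientAddGroup.eq_zero_iff _).2 (AddSubgroup.subset_closure ⟨y, r, q, rfl⟩)

lemma tmulHom_act (g : X → Q) (y : M) (s : X →₀ R) :
    tmulHom M g (act y s) =
      QuotientAddGroup.mk' (balancing R M Q) (y ⊗ₜ[ℤ] Finsupp.linearCombination R g s) := by
  induction s using Finsupp.induction_linear with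
  | zero => simp
  | add s t hs ht => rw [act_add, map_add, hs, ht, map_add, TensorProduct.tmul_add, map_add]
  | single x r =>
    rw [act_single, tmulHom_single, mk_op_smul_tmul, Finsupp.linearCombination_single]

lemma tmulHom_eq_zero_of_mem {g : X → Q} {m : X →₀ M} {N : Submodule R (X →₀ R)}
    (hN : N ≤ LinearMap.ker (Finsupp.linearCombination R g))
    (hm : m ∈ spanAct (⊤ : Submodule Rᵐᵒᵖ M) N) : tmulHom (R := R) M g m = 0 := by
  refine spanAct_le (A := (tmulHom (R := R) M g).ker) (fun y _ s hs => ?_) hm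
  rw [AddMonoidHom.mem_ker, tmulHom_act, LinearMap.mem_ker.1 (hN hs), TensorProduct.tmul_zero,
    map_zero]

/-- Right exactness of M ⊗ -: choosing preimages of the elements of Q defines a map back from M ⊗ Q
to M^(X) modulo the image of M ⊗ K, independent of the choice. -/
lemma mem_spanAct_of_tmulHom_eq_zero {g : X → Q}
    (hg : Function.Surjective (Finsupp.linearCombination R g)) {m : X →₀ M}
    (hm : tmulHom (R := R) M g m = 0) :
    m ∈ spanAct (⊤ : Submodule Rᵐᵒᵖ M) (LinearMap.ker (Finsupp.linearCombination R g)) := by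
  set K := LinearMap.ker (Finsupp.linearCombination R g) with hK
  set A := spanAct (⊤ : Submodule Rᵐᵒᵖ M) K with hA
  choose σ hσ using hg
  have congr : ∀ (y : M) {s t : X →₀ R},
      Finsupp.linearCombination R g s = Finsupp.linearCombination R g t →
      QuotientAddGroup.mk' A (act y s) = QuotientAddGroup.mk' A (act y t) := by
    intro y s t h
    rw [← sub_eq_zero, ← map_sub, ← act_sub]
    exact (QuotientAddGroup.eq_zero_iff _).2 (act_mem trivial (by simp [hK, h]))
  let f : M →+ Q →+ (X →₀ M) ⧸ A := AddMonoidHom.mk'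
    (fun y => AddMonoidHom.mk' (fun q => QuotientAddGroup.mk' A (act y (σ q))) (fun q q' => by
      rw [← map_add, ← act_add]; exact congr y (by simp [hσ])))
    (fun y z => AddMonoidHom.ext fun q => by
      change QuotientAddGroup.mk' A _ = QuotientAddGroup.mk' A _ + QuotientAddGroup.mk' A _
      rw [add_act, map_add])
  let F : M ⊗[ℤ] Q →+ (X →₀ M) ⧸ A := TensorProduct.liftAddHom f (fun n y q => by
    rw [map_zsmul, map_zsmul]; rfl)
  have hF : balancing R M Q ≤ F.ker := by
    refine (AddSubgroup.closure_le _).2 ?_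
    rintro _ ⟨y, r, q, rfl⟩
    change F _ = 0
    rw [map_sub, sub_eq_zero]
    change QuotientAddGroup.mk' A _ = QuotientAddGroup.mk' A _
    rw [op_smul_act]
    exact congr y (by simp [hσ])
  have key : (QuotientAddGroup.lift _ F hF).comp (tmulHom (R := R) M g) =
      QuotientAddGroup.mk' A := by
    refine Finsupp.addHom_ext fun x y => ?_
    rw [AddMonoidHom.comp_apply, tmulHom_single]
    change QuotientAddGroup.mk' A (act y (σ (g x))) = _
    rw [congr y (t := Finsupp.single x 1) (by simp [hσ]), act_single]
    simp
  have := DFunLike.congr_fun key m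
  rw [AddMonoidHom.comp_apply, hm, map_zero] at this
  exact (QuotientAddGroup.eq_zero_iff _).1 this.symm

lemma map_tmulHom (f : Q →ₗ[R] Q') (g : X → Q) (m : X →₀ M) :
    Tensor.map R M f (tmulHom M g m) = tmulHom M (f ∘ g) m := by
  refine DFunLike.congr_fun (f := (Tensor.map R M f).comp (tmulHom M g)) ?_ m
  refine Finsupp.addHom_ext fun x y => ?_
  rw [AddMonoidHom.comp_apply, tmulHom_single, tmulHom_single]
  rfl

lemma tmulHom_id_surjective : Function.Surjective (tmulHom (R := R) M (id : Q → Q)) := by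
  intro t
  obtain ⟨t, rfl⟩ := QuotientAddGroup.mk'_surjective _ t
  change t ∈ (tmulHom (R := R) M (id : Q → Q)).range.comap (QuotientAddGroup.mk' _)
  induction t using TensorProduct.induction_on with
  | zero => exact zero_mem _
  | tmul y q => exact ⟨Finsupp.single q y, tmulHom_single _ _ _⟩
  | add a b ha hb => exact add_mem ha hb

lemma linearCombination_surjective_of_surjective {g : X → Q} (hg : Function.Surjective g) :
    Function.Surjective (Finsupp.linearCombination R g) := fun q => by
  obtain ⟨x, rfl⟩ := hg q
  exact ⟨Finsupp.single x 1, by simp⟩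

lemma linearCombination_mkQ_single (N : Submodule R (X →₀ R)) :
    Finsupp.linearCombination R (fun x => N.mkQ (Finsupp.single x 1)) = N.mkQ := by
  ext x; simp

lemma ker_linearCombination_mkQ_single (N : Submodule R (X →₀ R)) :
    LinearMap.ker (Finsupp.linearCombination R (fun x => N.mkQ (Finsupp.single x 1))) = N := by
  rw [linearCombination_mkQ_single, Submodule.ker_mkQ]

/-- The canonical embedding of `R^(X) / ⋂ N` into `∏ R^(X) / N`. -/
noncomputable def quotientSInfToPi (𝒩 : Set (Submodule R (X →₀ R))) :
    ((X →₀ R) ⧸ sInf 𝒩) →ₗ[R] ((N : 𝒩) → (X →₀ R) ⧸ N.1) :=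
  LinearMap.pi fun N => Submodule.factor (sInf_le N.2)

lemma quotientSInfToPi_injective (𝒩 : Set (Submodule R (X →₀ R))) :
    Function.Injective (quotientSInfToPi 𝒩) := by
  rw [injective_iff_map_eq_zero]
  intro s hs
  obtain ⟨s, rfl⟩ := Submodule.mkQ_surjective _ s
  refine (Submodule.Quotient.mk_eq_zero _).2 (Submodule.mem_sInf.2 fun N hN => ?_)
  exact (Submodule.Quotient.mk_eq_zero _).1 (congrFun hs ⟨N, hN⟩)

lemma rho_tmulHom {ι : Type u} {P : ι → Type u} [∀ i, AddCommGroup (P i)] [∀ i, Module R (P i)]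
    (g : X → (i : ι) → P i) (m : X →₀ M) (i : ι) :
    rho R M P (tmulHom M g m) i = tmulHom M (fun x => g x i) m :=
  map_tmulHom (LinearMap.proj (R := R) (φ := P) i) g m

lemma tmulHom_eq_zero_of_forall (hf : IsFlat R M) (hm : IsMittagLeffler R M) {ι : Type u}
    {P : ι → Type u} [∀ i, AddCommGroup (P i)] [∀ i, Module R (P i)]
    (f : Q →ₗ[R] ((i : ι) → P i)) (hfi : Function.Injective f) (g : X → Q) (m : X →₀ M)
    (h : ∀ i, tmulHom (R := R) M (fun x => f (g x) i) m = 0) : tmulHom (R := R) M g m = 0 := by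
  have h1 : tmulHom (R := R) M (f ∘ g) m = 0 := by
    refine hm ι P ?_
    rw [map_zero]
    funext i
    rw [rho_tmulHom]
    exact h i
  refine hf Q ((i : ι) → P i) f hfi ?_
  rw [map_zero, ← h1]
  exact map_tmulHom f g m

/-- R^(X)/⋂N embeds in ∏ R^(X)/N. Flatness keeps the embedding injective after tensoring, and the
Mittag-Leffler property lets one test vanishing in each factor. -/
theorem hasContents_of_flat_of_mittagLeffler (hf : IsFlat R M) (hm : IsMittagLeffler R M) :
    HasContents (⊤ : Submodule Rᵐᵒᵖ M) := by
  intro X 𝒩 m _ h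
  have h0 : tmulHom (R := R) M (fun x => (sInf 𝒩).mkQ (Finsupp.single x 1)) m = 0 := by
    refine tmulHom_eq_zero_of_forall hf hm (P := fun N : 𝒩 => (X →₀ R) ⧸ N.1)
      (quotientSInfToPi 𝒩) (quotientSInfToPi_injective 𝒩) _ _ fun N => ?_
    refine Eq.trans ?_ (tmulHom_eq_zero_of_mem (ker_linearCombination_mkQ_single N.1).ge (h _ N.2))
    rfl
  have := mem_spanAct_of_tmulHom_eq_zero
    (by rw [linearCombination_mkQ_single]; exact Submodule.mkQ_surjective _) h0
  rwa [ker_linearCombination_mkQ_single] at this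

/-- Present Q and Q' by the free modules on their elements. A tensor killed by f lifts to an element
over both the relations of Q' and the image of R^(Q); as f is injective, the intersection of these
consists of images of relations of Q. -/
theorem HasContents.isFlat (h : HasContents (⊤ : Submodule Rᵐᵒᵖ M)) : IsFlat R M := by
  intro Q Q' _ _ _ _ f hf
  rw [injective_iff_map_eq_zero]
  intro t ht
  obtain ⟨m, rfl⟩ := tmulHom_id_surjective t
  rw [map_tmulHom, Function.comp_id] at ht
  let φ : (Q →₀ R) →ₗ[R] (Q' →₀ R) := Finsupp.lmapDomain R R f
  have hφ : ∀ s, Finsupp.linearCombination R (id : Q' → Q') (φ s) =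
      Finsupp.linearCombination R (f : Q → Q') s :=
    fun s => Finsupp.linearCombination_mapDomain R (f : Q → Q') s
  have hφ' : ∀ s, Finsupp.linearCombination R (f : Q → Q') s =
      f (Finsupp.linearCombination R (id : Q → Q) s) := fun s => by
    simp [Finsupp.linearCombination_apply, map_finsuppSum]
  have h1 : tmulHom (R := R) M id (extend M φ m) = 0 := by
    rw [← ht]
    refine DFunLike.congr_fun (f := (tmulHom (R := R) M id).comp (extend M φ))
      (addHom_ext_act R fun y s => ?_) m
    rw [AddMonoidHom.comp_apply, extend_act, tmulHom_act, tmulHom_act, hφ]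
  have h2 := mem_spanAct_of_tmulHom_eq_zero
    (linearCombination_surjective_of_surjective Function.surjective_id) h1
  have h3 : extend M φ m ∈ spanAct (⊤ : Submodule Rᵐᵒᵖ M) (LinearMap.range φ) := by
    rw [← Submodule.map_top]; exact extend_mem φ (mem_top_spanAct_top m)
  have h4 := h _ {LinearMap.ker (Finsupp.linearCombination R (id : Q' → Q')), LinearMap.range φ} _
    (fun _ => trivial) (by rintro N (rfl | rfl) <;> assumption)
  -- Restriction of coordinates along the injection f brings the intersection back to R^(Q).
  obtain ⟨ψ, hψ⟩ : ∃ ψ : (Q' →₀ R) →ₗ[R] (Q →₀ R), ψ ∘ₗ φ = LinearMap.id :=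
    ⟨Finsupp.lcomapDomain f hf,
      LinearMap.ext (Finsupp.leftInverse_lcomapDomain_mapDomain (R := R) f hf)⟩
  have h5 := extend_mem ψ h4
  rw [extend_extend, hψ, extend_id] at h5
  refine tmulHom_eq_zero_of_mem (R := R) ?_ h5
  rw [sInf_pair]
  rintro _ ⟨_, ⟨h6, ⟨s, rfl⟩⟩, rfl⟩
  have h8 : ψ (φ s) = s := LinearMap.congr_fun hψ s
  rw [h8, LinearMap.mem_ker]
  apply hf
  have h7 : Finsupp.linearCombination R (id : Q' → Q') (φ s) = 0 := h6
  rw [map_zero, ← h7, hφ, hφ']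

/-- The relations among elements of ∏ Q i are the intersection over i of the relations among their
i-th coordinates. -/
theorem HasContents.isMittagLeffler (h : HasContents (⊤ : Submodule Rᵐᵒᵖ M)) :
    IsMittagLeffler R M := by
  intro ι Q _ _
  rw [injective_iff_map_eq_zero]
  intro t ht
  obtain ⟨m, rfl⟩ := tmulHom_id_surjective t
  classical
  have h1 : ∀ i, m ∈ spanAct (⊤ : Submodule Rᵐᵒᵖ M)
      (LinearMap.ker (Finsupp.linearCombination R (fun q : ((i : ι) → Q i) => q i))) := by
    intro i
    refine mem_spanAct_of_tmulHom_eq_zero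
      (linearCombination_surjective_of_surjective (Function.surjective_eval i)) ?_
    have := congrFun ht i
    change Tensor.map R M _ (tmulHom M id m) = 0 at this
    rwa [map_tmulHom] at this
  have h2 := h _ (Set.range fun i =>
    LinearMap.ker (Finsupp.linearCombination R (fun q : ((i : ι) → Q i) => q i))) m
    (fun _ => trivial) (by rintro _ ⟨i, rfl⟩; exact h1 i)
  refine tmulHom_eq_zero_of_mem (fun s hs => ?_) h2
  rw [LinearMap.mem_ker]
  funext i
  have := Submodule.mem_sInf.1 hs _ ⟨i, rfl⟩
  rw [LinearMap.mem_ker, Finsupp.linearCombination_apply] at this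
  rw [Finsupp.linearCombination_apply, Finsupp.sum, Finset.sum_apply]
  exact this

theorem flatMittagLeffler_iff (M : ModuleCat.{u} Rᵐᵒᵖ) :
    flatMittagLeffler R M ↔ HasContents (⊤ : Submodule Rᵐᵒᵖ M) :=
  ⟨fun h => hasContents_of_flat_of_mittagLeffler h.1 h.2, fun h => ⟨h.isFlat, h.isMittagLeffler⟩⟩

end TensorBridge

end FlatML

namespace FlatML

/-! ### Local projectivity, purity and transfinite extensions -/

section Closure

variable {R : Type u} [Ring R] {M : Type u} [AddCommGroup M] [Module Rᵐᵒᵖ M]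
  {M' : Type u} [AddCommGroup M'] [Module Rᵐᵒᵖ M'] {X Y : Type u}

lemma HasContents.of_retract (h : HasContents (⊤ : Submodule Rᵐᵒᵖ M')) (i : M →ₗ[Rᵐᵒᵖ] M')
    (p : M' →ₗ[Rᵐᵒᵖ] M) (hpi : ∀ x, p (i x) = x) : HasContents (⊤ : Submodule Rᵐᵒᵖ M) := by
  intro X 𝒩 m _ hm
  have h1 := h X 𝒩 (mapCoeff i m) (fun _ => trivial)
    fun N hN => spanAct_mono le_top le_rfl (mapCoeff_mem i (hm N hN))
  have h2 : mapCoeff p (mapCoeff i m) = m := by ext x; simp [hpi]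
  rw [← h2]
  exact spanAct_mono le_top le_rfl (mapCoeff_mem p h1)

lemma HasContents.of_linearEquiv (h : HasContents (⊤ : Submodule Rᵐᵒᵖ M')) (e : M ≃ₗ[Rᵐᵒᵖ] M') :
    HasContents (⊤ : Submodule Rᵐᵒᵖ M) :=
  h.of_retract e.toLinearMap e.symm.toLinearMap (by simp)

/-- Modules in which each finite set is fixed by an endomorphism that factors through a finitely
generated free module. -/
def IsLocallyProjective (R : Type u) [Ring R] (M : Type u) [AddCommGroup M] [Module Rᵐᵒᵖ M] :
    Prop :=
  ∀ s : Finset M, ∃ (ι : Type u) (t : Finset ι) (y : ι → M) (f : ι → M →ₗ[Rᵐᵒᵖ] R),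
    ∀ x ∈ s, x = ∑ i ∈ t, MulOpposite.op (f i x) • y i

lemma mapCoeff_mem_of_mem_spanAct {N : Submodule R (X →₀ R)} {m : X →₀ M}
    {G : Submodule Rᵐᵒᵖ M} (hm : m ∈ spanAct G N) (f : M →ₗ[Rᵐᵒᵖ] R) : mapCoeff f m ∈ N := by
  refine spanAct_le (A := N.toAddSubgroup.comap (mapCoeff f)) (fun y _ s hs => ?_) hm
  have : mapCoeff f (act y s) = f y • s := by ext x; simp
  change mapCoeff f (act y s) ∈ N
  rw [this]
  exact N.smul_mem _ hs

/-- Writing m = ∑ y i ⊗ f i(m) with functionals f i, each f i(m) lies in every N over which m lies,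
hence in the intersection. -/
theorem IsLocallyProjective.hasContents (h : IsLocallyProjective R M) :
    HasContents (⊤ : Submodule Rᵐᵒᵖ M) := by
  classical
  intro X 𝒩 m _ hm
  obtain ⟨ι, t, y, f, hf⟩ := h (m.support.image m)
  have : m = ∑ i ∈ t, act (y i) (mapCoeff (f i) m) := by
    ext x
    rw [Finsupp.finsetSum_apply]
    by_cases hx : x ∈ m.support
    · exact hf _ (Finset.mem_image_of_mem _ hx)
    · simp [Finsupp.notMem_support_iff.1 hx]
  rw [this]
  exact AddSubgroup.sum_mem _ fun i _ => act_mem trivial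
    (Submodule.mem_sInf.2 fun N hN => mapCoeff_mem_of_mem_spanAct (hm N hN) (f i))

lemma isLocallyProjective_of_projective [Module.Projective Rᵐᵒᵖ M] : IsLocallyProjective R M := by
  classical
  intro s
  obtain ⟨g, hg⟩ := Module.projective_def'.1 ‹Module.Projective Rᵐᵒᵖ M›
  let e : Rᵐᵒᵖ →ₗ[Rᵐᵒᵖ] R := (MulOpposite.opLinearEquiv Rᵐᵒᵖ (M := R)).symm.toLinearMap
  refine ⟨M, s.biUnion fun x => (g x).support, id,
    fun i => (e ∘ₗ Finsupp.lapply i) ∘ₗ g, fun x hx => ?_⟩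
  have h1 : Finsupp.linearCombination Rᵐᵒᵖ id (g x) = x := LinearMap.congr_fun hg x
  rw [Finsupp.linearCombination_apply, Finsupp.sum_of_support_subset (s := s.biUnion
    fun x => (g x).support) _ (Finset.subset_biUnion_of_mem (fun x => (g x).support) hx) _
    (by simp)] at h1
  exact h1.symm

lemma exists_mapCoeff_eq {G : Submodule Rᵐᵒᵖ M} {N : Submodule R (X →₀ R)} (p : M →ₗ[Rᵐᵒᵖ] M')
    {w : X →₀ M'} (hw : w ∈ spanAct (G.map p) N) : ∃ v ∈ spanAct G N, mapCoeff p v = w := by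
  have : spanAct (G.map p) N ≤ (spanAct G N).map (mapCoeff p) := by
    refine spanAct_le ?_
    rintro _ ⟨y, hy, rfl⟩ s hs
    exact ⟨act y s, act_mem hy hs, mapCoeff_act p y s⟩
  exact this hw

lemma extend_eq_zero_of_mem {G : Submodule Rᵐᵒᵖ M} (φ : (X →₀ R) →ₗ[R] (Y →₀ R)) {m : X →₀ M}
    (hm : m ∈ spanAct G (LinearMap.ker φ)) : extend M φ m = 0 := by
  refine spanAct_le (A := (extend M φ).ker) (fun y _ s hs => ?_) hm
  rw [AddMonoidHom.mem_ker, extend_act, LinearMap.mem_ker.1 hs, act_zero]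

/-- Purity of `A` in `G`. -/
def IsPureIn (R : Type u) [Ring R] {M : Type u} [AddCommGroup M] [Module Rᵐᵒᵖ M]
    (A G : Submodule Rᵐᵒᵖ M) : Prop :=
  ∀ (X : Type u) (N : Submodule R (X →₀ R)) (m : X →₀ M), (∀ x, m x ∈ A) → m ∈ spanAct G N →
    m ∈ spanAct A N

variable {A G : Submodule Rᵐᵒᵖ M} {p : G →ₗ[Rᵐᵒᵖ] M'}

lemma mapCoeff_subtype_injective (G : Submodule Rᵐᵒᵖ M) :
    Function.Injective (mapCoeff (X := X) G.subtype) := fun v w h => by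
  ext x; exact DFunLike.congr_fun h x

lemma exists_mapCoeff_subtype_eq {N : Submodule R (X →₀ R)} {m : X →₀ M} (hm : m ∈ spanAct G N) :
    ∃ v ∈ spanAct (⊤ : Submodule Rᵐᵒᵖ G) N, mapCoeff G.subtype v = m :=
  exists_mapCoeff_eq G.subtype (by rwa [Submodule.map_subtype_top])

lemma exists_mapCoeff_of_surjective (hp : Function.Surjective p) {N : Submodule R (X →₀ R)}
    {w : X →₀ M'} (hw : w ∈ spanAct (⊤ : Submodule Rᵐᵒᵖ M') N) :
    ∃ v ∈ spanAct (⊤ : Submodule Rᵐᵒᵖ G) N, mapCoeff p v = w :=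
  exists_mapCoeff_eq p (by rwa [Submodule.map_top, LinearMap.range_eq_top.2 hp])

lemma mapCoeff_subtype_mem {N : Submodule R (X →₀ R)} {v : X →₀ G}
    (hv : v ∈ spanAct (⊤ : Submodule Rᵐᵒᵖ G) N) : mapCoeff G.subtype v ∈ spanAct G N := by
  simpa [Submodule.map_subtype_top] using mapCoeff_mem G.subtype hv

/-- A submodule with flat quotient is pure: lift m to coefficients on generators of N. Modulo A
these form a relation, which by `mem_ker` is induced by relations among the generators; subtracting
a lift of it moves the coefficients into A without changing m. -/
lemma isPureIn_of_hasContents (hp : Function.Surjective p) (hker : ∀ y, p y = 0 ↔ (y : M) ∈ A)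
    (h : HasContents (⊤ : Submodule Rᵐᵒᵖ M')) : IsPureIn R A G := by
  intro X N m hmA hm
  obtain ⟨z, hzG, hz⟩ := exists_extend_relMap hm
  obtain ⟨v, -, rfl⟩ := exists_mapCoeff_subtype_eq (mem_spanAct_top (R := R).2 hzG)
  have h0 : extend M' (relMap N) (mapCoeff p v) = 0 := by
    rw [← mapCoeff_extend]
    ext x
    rw [mapCoeff_apply, Finsupp.zero_apply, hker]
    rw [← mapCoeff_extend] at hz
    have := hmA x
    rwa [← hz] at this
  obtain ⟨w, hw, hwv⟩ := exists_mapCoeff_of_surjective hp (h.mem_ker _ (fun _ => trivial) h0)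
  have h1 : extend M (relMap N) (mapCoeff G.subtype (v - w)) = m := by
    rw [map_sub, map_sub, hz, ← mapCoeff_extend, extend_eq_zero_of_mem _ hw, map_zero, sub_zero]
  have h2 : mapCoeff G.subtype (v - w) ∈ spanAct A (⊤ : Submodule R (N →₀ R)) := by
    refine mem_spanAct_top.2 fun n => (hker _).1 ?_
    rw [← mapCoeff_apply, map_sub, hwv, sub_self, Finsupp.zero_apply]
  have h3 := extend_mem (relMap N) h2
  rwa [h1, Submodule.map_top, range_relMap] at h3

/-- Solve the problem in the quotient, lift the solution to G, and solve for the difference in A;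
purity of A shows that the difference still lies over each N with coefficients in A. -/
lemma HasContents.of_extension (hAG : A ≤ G) (hp : Function.Surjective p)
    (hker : ∀ y, p y = 0 ↔ (y : M) ∈ A) (h : HasContents (⊤ : Submodule Rᵐᵒᵖ M'))
    (hA : HasContents A) : HasContents G := by
  intro X 𝒩 m hmG hm
  obtain ⟨v, -, rfl⟩ := exists_mapCoeff_subtype_eq (mem_spanAct_top (R := R).2 hmG)
  have h1 : ∀ N ∈ 𝒩, mapCoeff p v ∈ spanAct ⊤ N := fun N hN => by
    obtain ⟨v', hv', he⟩ := exists_mapCoeff_subtype_eq (hm N hN)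
    rw [mapCoeff_subtype_injective G he] at hv'
    exact spanAct_mono le_top le_rfl (mapCoeff_mem p hv')
  obtain ⟨w, hw, hwv⟩ := exists_mapCoeff_of_surjective hp (h X 𝒩 _ (fun _ => trivial) h1)
  have hw' := mapCoeff_subtype_mem hw
  have h2 : ∀ x, mapCoeff G.subtype (v - w) x ∈ A := fun x => (hker _).1 (by
    rw [← mapCoeff_apply, map_sub, hwv, sub_self, Finsupp.zero_apply])
  have h3 : mapCoeff G.subtype (v - w) ∈ spanAct A (sInf 𝒩) := hA X 𝒩 _ h2 fun N hN =>
    isPureIn_of_hasContents hp hker h X N _ h2 (by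
      rw [map_sub]
      exact sub_mem (hm N hN) (spanAct_mono le_rfl (sInf_le hN) hw'))
  have h4 := add_mem (spanAct_mono hAG le_rfl h3) hw'
  rwa [map_sub, sub_add_cancel] at h4

lemma IsFiltration.exists_lt_forall_mem {l : Ordinal.{u}} {F : Ordinal.{u} → Submodule Rᵐᵒᵖ M}
    (hF : IsFiltration l F) {β : Ordinal.{u}} (hβ : β ≤ l) (hlim : Order.IsSuccLimit β)
    (m : X →₀ M) (hm : ∀ x, m x ∈ F β) : ∃ γ < β, ∀ x, m x ∈ F γ := by
  classical
  have hpos : (0 : Ordinal) < β := hlim.bot_lt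
  have key : ∀ s : Finset X, ∃ γ < β, ∀ x ∈ s, m x ∈ F γ := by
    intro s
    induction s using Finset.induction_on with
    | empty => exact ⟨0, hpos, by simp⟩
    | insert a s _ ih =>
      obtain ⟨γ, hγ, h⟩ := ih
      have h1 : m a ∈ (F β : Set M) := hm a
      rw [hF.limit β hβ hlim] at h1
      simp only [Set.mem_iUnion] at h1
      obtain ⟨δ, hδ, h1⟩ := h1
      have hmax : max γ δ < β := max_lt hγ hδ
      refine ⟨max γ δ, hmax, fun x hx => ?_⟩
      rcases Finset.mem_insert.1 hx with rfl | hx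
      · exact hF.mono _ _ (le_max_right _ _) (hmax.le.trans hβ) h1
      · exact hF.mono _ _ (le_max_left _ _) (hmax.le.trans hβ) (h x hx)
  obtain ⟨γ, hγ, h⟩ := key m.support
  refine ⟨γ, hγ, fun x => ?_⟩
  by_cases hx : x ∈ m.support
  · exact h x hx
  · rw [Finsupp.notMem_support_iff.1 hx]; exact zero_mem _

/-- Purity of earlier terms is carried along the induction: at a limit, a finitely supported family
already lies in an earlier term, and purity lets membership over each N be tested there. -/
theorem IsFiltration.hasContents {l : Ordinal.{u}} {F : Ordinal.{u} → Submodule Rᵐᵒᵖ M}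
    (hF : IsFiltration l F)
    (h : ∀ α < l, HasContents (R := R)
      (⊤ : Submodule Rᵐᵒᵖ (F (Order.succ α) ⧸ (F α).submoduleOf (F (Order.succ α))))) :
    HasContents (⊤ : Submodule Rᵐᵒᵖ M) := by
  have key : ∀ β : Ordinal.{u}, β ≤ l → HasContents (R := R) (F β) ∧
      ∀ α ≤ β, IsPureIn R (F α) (F β) := by
    intro β
    induction β using Ordinal.limitRecOn with
    | zero =>
      intro _
      refine ⟨fun X 𝒩 m hm _ => ?_, fun α hα X N m _ hm => ?_⟩
      · have : m = 0 := by
          ext x; have := hm x; rw [hF.zero] at this; simpa using this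
        rw [this]; exact zero_mem _
      · rwa [le_antisymm hα (zero_le)]
    | add_one γ ih =>
      rw [← Order.succ_eq_add_one]
      intro hβ
      have hγ : γ < l := (Order.lt_succ γ).trans_le hβ
      obtain ⟨ih1, ih2⟩ := ih hγ.le
      have hle := hF.mono γ (Order.succ γ) (Order.le_succ γ) hβ
      have hp := Submodule.mkQ_surjective ((F γ).submoduleOf (F (Order.succ γ)))
      have hker : ∀ y, ((F γ).submoduleOf (F (Order.succ γ))).mkQ y = 0 ↔ (y : M) ∈ F γ :=
        fun y => Submodule.Quotient.mk_eq_zero _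
      refine ⟨HasContents.of_extension hle hp hker (h γ hγ) ih1, fun α hα => ?_⟩
      rcases hα.eq_or_lt with rfl | hα
      · exact fun X N m _ hm => hm
      · have hα := Order.lt_succ_iff.1 hα
        exact fun X N m hmα hm => ih2 α hα X N m hmα
          (isPureIn_of_hasContents hp hker (h γ hγ) X N m
            (fun x => hF.mono _ _ hα hγ.le (hmα x)) hm)
    | limit β hlim ih =>
      intro hβ
      have hpure : ∀ α ≤ β, IsPureIn R (F α) (F β) := by
        intro α hα
        rcases hα.eq_or_lt with rfl | hα
        · exact fun X N m _ hm => hm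
        intro X N m hmα hm
        obtain ⟨z, hz, rfl⟩ := exists_extend_relMap hm
        obtain ⟨γ, hγ, hzγ⟩ := hF.exists_lt_forall_mem hβ hlim z hz
        have hmax : max α γ < β := max_lt hα hγ
        refine (ih _ hmax (hmax.le.trans hβ)).2 α (le_max_left _ _) X N _ hmα ?_
        have := extend_mem (relMap N) (mem_spanAct_top (R := R).2 hzγ)
        rw [Submodule.map_top, range_relMap] at this
        exact spanAct_mono (hF.mono _ _ (le_max_right _ _) (hmax.le.trans hβ)) le_rfl this
      refine ⟨fun X 𝒩 m hm hN => ?_, hpure⟩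
      obtain ⟨γ, hγ, hmγ⟩ := hF.exists_lt_forall_mem hβ hlim m hm
      exact spanAct_mono (hF.mono _ _ hγ.le hβ) le_rfl ((ih γ hγ (hγ.le.trans hβ)).1 X 𝒩 m hmγ
        fun N h => hpure γ hγ.le X N m hmγ (hN N h))
  have := (key l le_rfl).1
  rwa [hF.top] at this

end Closure

end FlatML

namespace FlatML

/-! ### The Bass module of a sequence -/

section Bass

variable {R : Type u} [Ring R] (a : ℕ → R)

/-- The product `a (k-1) * ⋯ * a n`, which is `1` for `k = n` and, by convention, `0` for
`k < n`. -/
def chainProd (n : ℕ) : ℕ → R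
  | 0 => if n = 0 then 1 else 0
  | k + 1 => if k + 1 = n then 1 else a k * chainProd n k

lemma chainProd_of_lt {n k : ℕ} (h : k < n) : chainProd a n k = 0 := by
  induction k with
  | zero => simp [chainProd, h.ne']
  | succ k ih => simp [chainProd, h.ne, ih (by omega)]

@[simp] lemma chainProd_self (n : ℕ) : chainProd a n n = 1 := by
  cases n <;> simp [chainProd]

lemma chainProd_succ_right {n k : ℕ} (h : n ≤ k) :
    chainProd a n (k + 1) = a k * chainProd a n k := by
  rw [chainProd, if_neg (by omega)]

lemma chainProd_mul {m n k : ℕ} (hmn : m ≤ n) (hnk : n ≤ k) :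
    chainProd a n k * chainProd a m n = chainProd a m k := by
  induction k, hnk using Nat.le_induction with
  | base => simp
  | succ k hk ih =>
    rw [chainProd_succ_right a hk, chainProd_succ_right a (hmn.trans hk), mul_assoc, ih]

lemma chainProd_eq (n k : ℕ) :
    chainProd a n k = (if k = n then 1 else 0) + chainProd a (n + 1) k * a n := by
  rcases lt_trichotomy k n with h | rfl | h
  · simp [chainProd_of_lt a h, h.ne, chainProd_of_lt a (h.trans (Nat.lt_succ_self n))]
  · simp [chainProd_of_lt a (Nat.lt_succ_self k)]
  · have := chainProd_mul a (Nat.le_succ n) h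
    rw [chainProd_succ_right a le_rfl, chainProd_self, mul_one] at this
    rw [if_neg h.ne', zero_add, this]

/-- Sequences that vanish eventually. -/
def eventuallyZero (R : Type u) [Ring R] : Submodule Rᵐᵒᵖ (ℕ → R) where
  carrier := {x | ∃ n, ∀ k ≥ n, x k = 0}
  zero_mem' := ⟨0, fun _ _ => rfl⟩
  add_mem' := by
    rintro x y ⟨n, hn⟩ ⟨m, hm⟩
    exact ⟨max n m, fun k hk => by
      simp [hn k ((le_max_left _ _).trans hk), hm k ((le_max_right _ _).trans hk)]⟩
  smul_mem' := by
    rintro r x ⟨n, hn⟩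
    exact ⟨n, fun k hk => by simp [hn k hk]⟩

/-- The Bass module of `a`, the direct limit of `R → R → R → ⋯` with `n`-th map the left
multiplication by `a n`, as a module of germs of sequences. -/
def Bass : Submodule Rᵐᵒᵖ ((ℕ → R) ⧸ eventuallyZero R) :=
  Submodule.span Rᵐᵒᵖ (Set.range fun n => (eventuallyZero R).mkQ (chainProd a n))

/-- The `n`-th generator of the Bass module. -/
def bassGen (n : ℕ) : Bass a :=
  ⟨(eventuallyZero R).mkQ (chainProd a n), Submodule.subset_span ⟨n, rfl⟩⟩

lemma bassGen_eq (n : ℕ) : bassGen a n = MulOpposite.op (a n) • bassGen a (n + 1) := by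
  apply Subtype.ext
  change (eventuallyZero R).mkQ _ = MulOpposite.op (a n) • (eventuallyZero R).mkQ _
  rw [← map_smul, ← sub_eq_zero, ← map_sub]
  refine (Submodule.Quotient.mk_eq_zero _).2 ⟨n + 1, fun k hk => ?_⟩
  simp [chainProd_eq a n k, show k ≠ n by omega]

lemma bassGen_eq_smul {n k : ℕ} (h : n ≤ k) :
    bassGen a n = MulOpposite.op (chainProd a n k) • bassGen a k := by
  induction k, h using Nat.le_induction with
  | base => simp
  | succ k hk ih => rw [ih, bassGen_eq a k, chainProd_succ_right a hk, smul_smul]; simp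

lemma exists_smul_bassGen_eq_zero {k : ℕ} {r : R} (h : MulOpposite.op r • bassGen a k = 0) :
    ∃ n, ∀ j ≥ n, chainProd a k j * r = 0 := by
  have h' := congrArg Subtype.val h
  change MulOpposite.op r • (eventuallyZero R).mkQ _ = 0 at h'
  rw [← map_smul] at h'
  exact (Submodule.Quotient.mk_eq_zero _).1 h'

lemma exists_eq_smul_bassGen (b : Bass a) :
    ∃ k₀, ∀ k ≥ k₀, ∃ r : R, b = MulOpposite.op r • bassGen a k := by
  obtain ⟨b, hb⟩ := b
  induction hb using Submodule.span_induction with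
  | mem x hx =>
    obtain ⟨n, rfl⟩ := hx
    exact ⟨n, fun k hk => ⟨_, bassGen_eq_smul a hk⟩⟩
  | zero => exact ⟨0, fun k _ => ⟨0, by simp; rfl⟩⟩
  | add x y hx hy ihx ihy =>
    obtain ⟨n, hn⟩ := ihx
    obtain ⟨m, hm⟩ := ihy
    refine ⟨max n m, fun k hk => ?_⟩
    obtain ⟨r, hr⟩ := hn k ((le_max_left _ _).trans hk)
    obtain ⟨s, hs⟩ := hm k ((le_max_right _ _).trans hk)
    refine ⟨r + s, ?_⟩
    rw [MulOpposite.op_add, add_smul, ← hr, ← hs]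
    rfl
  | smul c x hx ih =>
    obtain ⟨n, hn⟩ := ih
    refine ⟨n, fun k hk => ?_⟩
    obtain ⟨r, hr⟩ := hn k hk
    refine ⟨r * c.unop, ?_⟩
    rw [MulOpposite.op_mul, MulOpposite.op_unop, mul_smul, ← hr]
    rfl

/-- The chain of principal left ideals `R a 0 ⊇ R (a 1 a 0) ⊇ ⋯` becomes stationary. -/
def IsStationary : Prop :=
  ∃ l, ∀ n, ∃ c, chainProd a 0 l = c * chainProd a 0 n

variable {a}

/-- Divisibility puts x over each left ideal generated by a(n-1)⋯a(0), hence over their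
intersection. Its image `bassGen a 0` is therefore a late generator times some s in the
intersection; comparing germs, a later product a(j-1)⋯a(0) is a left multiple of s. The formulation
with p, rather than with U = B, is needed for quotients of tree modules. -/
theorem isStationary_of_hasContents {U : Type u} [AddCommGroup U] [Module Rᵐᵒᵖ U]
    (hU : HasContents (⊤ : Submodule Rᵐᵒᵖ U)) (p : U →ₗ[Rᵐᵒᵖ] Bass a) (x : U)
    (hx : p x = bassGen a 0) (hdiv : ∀ n, ∃ w : U, x = MulOpposite.op (chainProd a 0 n) • w) :
    IsStationary a := by
  let N : ℕ → Submodule R (PUnit.{u + 1} →₀ R) := fun n =>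
    Submodule.span R {Finsupp.single PUnit.unit (chainProd a 0 n)}
  have h1 := hU PUnit.{u + 1} (Set.range N) (Finsupp.single PUnit.unit x) (fun _ => trivial) (by
    rintro _ ⟨n, rfl⟩
    obtain ⟨w, hw⟩ := hdiv n
    rw [hw, ← act_single]
    exact act_mem trivial (Submodule.mem_span_singleton_self _))
  -- Asked for all large k, so that two summands can be written over a common generator.
  have h2 : ∀ t ∈ spanAct (⊤ : Submodule Rᵐᵒᵖ U) (sInf (Set.range N)), ∃ k₀, ∀ k ≥ k₀,
      ∃ s : R, (∀ n, ∃ c, s = c * chainProd a 0 n) ∧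
        p (t PUnit.unit) = MulOpposite.op s • bassGen a k := by
    intro t ht
    induction ht using AddSubgroup.closure_induction with
    | mem t ht =>
      obtain ⟨y, -, s, hs, rfl⟩ := ht
      obtain ⟨k₀, h⟩ := exists_eq_smul_bassGen a (p y)
      refine ⟨k₀, fun k hk => ?_⟩
      obtain ⟨r, hr⟩ := h k hk
      refine ⟨r * s PUnit.unit, fun n => ?_, ?_⟩
      · obtain ⟨c, hc⟩ := Submodule.mem_span_singleton.1 (Submodule.mem_sInf.1 hs _ ⟨n, rfl⟩)
        exact ⟨r * c, by rw [← hc]; simp [mul_assoc]⟩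
      · rw [act_apply, map_smul, hr, smul_smul]; rfl
    | zero => exact ⟨0, fun k _ => ⟨0, fun n => ⟨0, by simp⟩, by simp⟩⟩
    | add t t' _ _ ih ih' =>
      obtain ⟨k₀, h⟩ := ih
      obtain ⟨k₁, h'⟩ := ih'
      refine ⟨max k₀ k₁, fun k hk => ?_⟩
      obtain ⟨s, hs, hs'⟩ := h k ((le_max_left _ _).trans hk)
      obtain ⟨r, hr, hr'⟩ := h' k ((le_max_right _ _).trans hk)
      refine ⟨s + r, fun n => ?_, ?_⟩
      · obtain ⟨c, hc⟩ := hs n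
        obtain ⟨d, hd⟩ := hr n
        exact ⟨c + d, by rw [hc, hd, add_mul]⟩
      · rw [Finsupp.add_apply, map_add, hs', hr', MulOpposite.op_add, add_smul]
    | neg t _ ih =>
      obtain ⟨k₀, h⟩ := ih
      refine ⟨k₀, fun k hk => ?_⟩
      obtain ⟨s, hs, hs'⟩ := h k hk
      refine ⟨-s, fun n => ?_, ?_⟩
      · obtain ⟨c, hc⟩ := hs n
        exact ⟨-c, by rw [hc, neg_mul]⟩
      · rw [Finsupp.neg_apply, map_neg, hs', MulOpposite.op_neg]
        exact (neg_smul (MulOpposite.op s) (bassGen a k)).symm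
  obtain ⟨k, h3⟩ := h2 _ h1
  obtain ⟨s, hs, h4⟩ := h3 k le_rfl
  rw [Finsupp.single_eq_same, hx, bassGen_eq_smul a (Nat.zero_le k), ← sub_eq_zero] at h4
  obtain ⟨j, h5⟩ := exists_smul_bassGen_eq_zero a (r := chainProd a 0 k - s)
    ((sub_smul (MulOpposite.op (chainProd a 0 k)) (MulOpposite.op s) (bassGen a k)).trans h4)
  have h6 := h5 (max j k) (le_max_left _ _)
  rw [mul_sub, sub_eq_zero, chainProd_mul a (Nat.zero_le k) (le_max_right _ _)] at h6
  refine ⟨max j k, fun n => ?_⟩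
  obtain ⟨c, hc⟩ := hs n
  exact ⟨chainProd a k (max j k) * c, by rw [h6, hc, mul_assoc]⟩

end Bass

end FlatML

namespace FlatML

/-! ### The tree module and its projection to Bass modules -/

section Tree

/-- The initial segment of length `n` of a branch of the tree of finite sequences in `K`. -/
def initSeg {K : Type u} (η : ℕ → K) (n : ℕ) : Σ n : ℕ, (Fin n → K) := ⟨n, fun i => η i⟩

variable {K : Type u} {R : Type u} [Ring R] (a : ℕ → R)

@[simp] lemma initSeg_fst (η : ℕ → K) (n : ℕ) : (initSeg η n).1 = n := rfl

lemma initSeg_injective (η : ℕ → K) : Function.Injective (initSeg η) := fun _ _ h =>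
  congrArg Sigma.fst h

lemma initSeg_eq_iff {η ζ : ℕ → K} {n : ℕ} : initSeg η n = initSeg ζ n ↔ ∀ i < n, η i = ζ i := by
  simp only [initSeg, Sigma.mk.injEq, heq_eq_eq, true_and, funext_iff, Fin.forall_iff]

lemma exists_separating (H : Finset (ℕ → K)) :
    ∃ n₀, ∀ n ≥ n₀, ∀ η ∈ H, ∀ ζ ∈ H, initSeg η n = initSeg ζ n → η = ζ := by
  classical
  have h : ∀ p : (ℕ → K) × (ℕ → K), ∃ n, ∀ m ≥ n, initSeg p.1 m = initSeg p.2 m → p.1 = p.2 := by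
    intro p
    by_cases hp : p.1 = p.2
    · exact ⟨0, fun _ _ _ => hp⟩
    · obtain ⟨i, hi⟩ := Function.ne_iff.1 hp
      exact ⟨i + 1, fun m hm he => (hi (initSeg_eq_iff.1 he i (by omega))).elim⟩
  choose f hf using h
  refine ⟨(H ×ˢ H).sup f, fun n hn η hη ζ hζ => hf (η, ζ) n ?_⟩
  exact (Finset.le_sup (f := f) (Finset.mk_mem_product hη hζ)).trans hn

open Classical in
/-- The element of `∏ R` attached to the branch `η` and to `n`; its value at the initial segment of
length `k ≥ n` of `η` is `a (k-1) * ⋯ * a n`. -/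
noncomputable def branchElt (η : ℕ → K) (n : ℕ) : (Σ n : ℕ, (Fin n → K)) → R :=
  fun τ => if initSeg η τ.1 = τ then chainProd a n τ.1 else 0

open Classical in
/-- The unit vector at the node `τ`. -/
noncomputable def nodeElt (R : Type u) [Ring R] (τ : Σ n : ℕ, (Fin n → K)) :
    (Σ n : ℕ, (Fin n → K)) → R := Pi.single τ 1

lemma nodeElt_of_ne {τ σ : Σ n : ℕ, (Fin n → K)} (h : σ ≠ τ) : nodeElt R τ σ = 0 := by
  simp [nodeElt, h]

@[simp] lemma nodeElt_self (τ : Σ n : ℕ, (Fin n → K)) : nodeElt R τ τ = 1 := by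
  simp [nodeElt]

lemma branchElt_of_lt (η : ℕ → K) {n : ℕ} {τ : Σ n : ℕ, (Fin n → K)} (h : τ.1 < n) :
    branchElt a η n τ = 0 := by
  simp [branchElt, chainProd_of_lt a h]

@[simp] lemma branchElt_initSeg (η : ℕ → K) (n k : ℕ) :
    branchElt a η n (initSeg η k) = chainProd a n k := by
  simp [branchElt]

lemma branchElt_of_ne {η : ℕ → K} {n : ℕ} {τ : Σ n : ℕ, (Fin n → K)} (h : initSeg η τ.1 ≠ τ) :
    branchElt a η n τ = 0 := if_neg h

lemma branchElt_eq (η : ℕ → K) (n : ℕ) : branchElt a η n =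
    nodeElt R (initSeg η n) + MulOpposite.op (a n) • branchElt a η (n + 1) := by
  funext τ
  rw [Pi.add_apply, Pi.smul_apply, op_smul_eq_mul]
  by_cases h : initSeg η τ.1 = τ
  · rw [← h, branchElt_initSeg, branchElt_initSeg, chainProd_eq]
    congr 1
    by_cases hn : τ.1 = n
    · rw [if_pos hn, hn, nodeElt_self]
    · rw [if_neg hn, nodeElt_of_ne (fun h' => hn (initSeg_injective η h'))]
  · rw [branchElt_of_ne a h, branchElt_of_ne a h, zero_mul, add_zero, nodeElt_of_ne]
    rintro rfl
    exact h rfl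

/-- The submodule generated by the nodes of level `< n` and by the `n`-th elements of the branches
in `H`. -/
noncomputable def treePiece (H : Set (ℕ → K)) (n : ℕ) :
    Submodule Rᵐᵒᵖ ((Σ n : ℕ, (Fin n → K)) → R) :=
  Submodule.span Rᵐᵒᵖ (nodeElt R '' {τ | τ.1 < n} ∪ (fun η => branchElt a η n) '' H)

lemma nodeElt_mem_treePiece (H : Set (ℕ → K)) {n : ℕ} {τ : Σ n : ℕ, (Fin n → K)} (h : τ.1 < n) :
    nodeElt R τ ∈ treePiece a H n :=
  Submodule.subset_span (Or.inl ⟨τ, h, rfl⟩)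

lemma branchElt_mem_treePiece {H : Set (ℕ → K)} {n m : ℕ} (hnm : m ≤ n) {η : ℕ → K} (h : η ∈ H) :
    branchElt a η m ∈ treePiece a H n := by
  induction hnm using Nat.decreasingInduction with
  | self => exact Submodule.subset_span (Or.inr ⟨η, h, rfl⟩)
  | of_succ k hk ih =>
    rw [branchElt_eq]
    exact add_mem (nodeElt_mem_treePiece a H hk) (Submodule.smul_mem _ _ ih)

lemma treePiece_mono {H H' : Set (ℕ → K)} {n n' : ℕ} (hH : H ⊆ H') (hn : n ≤ n') :
    treePiece a H n ≤ treePiece a H' n' := by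
  refine Submodule.span_le.2 ?_
  rintro _ (⟨τ, hτ, rfl⟩ | ⟨η, hη, rfl⟩)
  · exact nodeElt_mem_treePiece a _ (lt_of_lt_of_le hτ hn)
  · exact branchElt_mem_treePiece a hn (hH hη)

/-- The submodule generated by the nodes. -/
noncomputable def nodeSpan (K : Type u) (R : Type u) [Ring R] :
    Submodule Rᵐᵒᵖ ((Σ n : ℕ, (Fin n → K)) → R) :=
  Submodule.span Rᵐᵒᵖ (Set.range (nodeElt R))

/-- The tree module of `a`. -/
noncomputable def TreeModule (K : Type u) (a : ℕ → R) :
    Submodule Rᵐᵒᵖ ((Σ n : ℕ, (Fin n → K)) → R) :=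
  Submodule.span Rᵐᵒᵖ (Set.range (nodeElt R) ∪
    Set.range fun p : (ℕ → K) × ℕ => branchElt a p.1 p.2)

lemma nodeElt_mem_treeModule (τ : Σ n : ℕ, (Fin n → K)) : nodeElt R τ ∈ TreeModule K a :=
  Submodule.subset_span (Or.inl ⟨τ, rfl⟩)

lemma branchElt_mem_treeModule (η : ℕ → K) (n : ℕ) : branchElt a η n ∈ TreeModule K a :=
  Submodule.subset_span (Or.inr ⟨(η, n), rfl⟩)

lemma exists_mem_treePiece {x : (Σ n : ℕ, (Fin n → K)) → R} (hx : x ∈ TreeModule K a) :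
    ∃ (H : Finset (ℕ → K)) (n : ℕ), x ∈ treePiece a (H : Set (ℕ → K)) n := by
  classical
  induction hx using Submodule.span_induction with
  | mem x hx =>
    rcases hx with ⟨τ, rfl⟩ | ⟨⟨η, n⟩, rfl⟩
    · exact ⟨∅, τ.1 + 1, nodeElt_mem_treePiece a _ (Nat.lt_succ_self _)⟩
    · exact ⟨{η}, n, branchElt_mem_treePiece a le_rfl (by simp)⟩
  | zero => exact ⟨∅, 0, zero_mem _⟩
  | add x y _ _ hx hy =>
    obtain ⟨H, n, hx⟩ := hx
    obtain ⟨H', n', hy⟩ := hy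
    refine ⟨H ∪ H', max n n', add_mem (treePiece_mono a ?_ (le_max_left _ _) hx)
      (treePiece_mono a ?_ (le_max_right _ _) hy)⟩ <;> simp
  | smul c x _ hx =>
    obtain ⟨H, n, hx⟩ := hx
    exact ⟨H, n, Submodule.smul_mem _ _ hx⟩

/-- Raising the level n until the finitely many branches in use have distinct initial segments of
length n makes the generators of the piece independent. -/
lemma exists_forall_mem_treePiece (s : Finset (TreeModule K a)) :
    ∃ (H : Finset (ℕ → K)) (n : ℕ), (∀ η ∈ H, ∀ ζ ∈ H, initSeg η n = initSeg ζ n → η = ζ) ∧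
      ∀ x ∈ s, (x : (Σ n : ℕ, (Fin n → K)) → R) ∈ treePiece a (H : Set (ℕ → K)) n := by
  classical
  have : ∃ (H : Finset (ℕ → K)) (n : ℕ), ∀ x ∈ s,
      (x : (Σ n : ℕ, (Fin n → K)) → R) ∈ treePiece a (H : Set (ℕ → K)) n := by
    choose H n h using fun x : TreeModule K a => exists_mem_treePiece a x.2
    refine ⟨s.biUnion H, s.sup n, fun x hx => treePiece_mono a ?_ (Finset.le_sup hx) (h x)⟩
    exact_mod_cast Finset.subset_biUnion_of_mem H hx
  obtain ⟨H, n, h⟩ := this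
  obtain ⟨n₀, hn₀⟩ := exists_separating H
  exact ⟨H, max n n₀, hn₀ _ (le_max_right _ _),
    fun x hx => treePiece_mono a subset_rfl (le_max_left _ _) (h x hx)⟩

lemma finite_of_mem_treePiece {H : Set (ℕ → K)} {n : ℕ} {x : (Σ n : ℕ, (Fin n → K)) → R}
    (hx : x ∈ treePiece a H n) : {τ | τ.1 < n ∧ x τ ≠ 0}.Finite := by
  induction hx using Submodule.span_induction with
  | mem x hx =>
    rcases hx with ⟨τ, -, rfl⟩ | ⟨η, -, rfl⟩
    · refine (Set.finite_singleton τ).subset fun σ hσ => ?_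
      by_contra h
      exact hσ.2 (nodeElt_of_ne h)
    · refine Set.finite_empty.subset fun σ hσ => hσ.2 (branchElt_of_lt a η hσ.1)
  | zero => simp
  | add x y _ _ hx hy =>
    refine (hx.union hy).subset fun τ hτ => ?_
    by_contra h
    simp only [Set.mem_union, Set.mem_ofPred_eq, not_or, not_and, not_not] at h
    exact hτ.2 (by simp [h.1 hτ.1, h.2 hτ.1])
  | smul c x _ hx =>
    refine hx.subset fun τ hτ => ⟨hτ.1, fun h => hτ.2 (by simp [h])⟩

/-- For separated branches, the coefficient of the n-th element of η is the value of x at the node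
of η of level n: there this element takes the value 1 and all other generators of the piece vanish.
-/
lemma apply_of_mem_treePiece {H : Finset (ℕ → K)} {n : ℕ} {x : (Σ n : ℕ, (Fin n → K)) → R}
    (hH : ∀ η ∈ H, ∀ ζ ∈ H, initSeg η n = initSeg ζ n → η = ζ)
    (hx : x ∈ treePiece a (H : Set (ℕ → K)) n) {τ : Σ n : ℕ, (Fin n → K)} (hτ : n ≤ τ.1) :
    x τ = ∑ η ∈ H, branchElt a η n τ * x (initSeg η n) := by
  induction hx using Submodule.span_induction with
  | mem x hx =>
    rcases hx with ⟨σ, hσ, rfl⟩ | ⟨η, hη, rfl⟩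
    · have hσ : σ.1 < n := hσ
      rw [nodeElt_of_ne (by rintro rfl; omega), Finset.sum_eq_zero]
      intro ζ _
      rw [nodeElt_of_ne (by rintro rfl; simp at hσ), mul_zero]
    · dsimp only
      rw [Finset.sum_eq_single_of_mem η hη, branchElt_initSeg, chainProd_self, mul_one]
      intro ζ hζ hne
      rw [branchElt_of_ne a (n := n) (τ := initSeg ζ n), mul_zero]
      exact fun h => hne (hH _ hη _ hζ h).symm
  | zero => simp
  | add x y _ _ hx hy => simp only [Pi.add_apply, hx, hy, mul_add, Finset.sum_add_distrib]
  | smul c x _ hx =>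
    rw [Pi.smul_apply, hx, Finset.smul_sum]
    exact Finset.sum_congr rfl fun η _ => by simp [MulOpposite.smul_eq_mul_unop, mul_assoc]

lemma eq_sum_of_mem_treePiece {H : Finset (ℕ → K)} {n : ℕ} {x : (Σ n : ℕ, (Fin n → K)) → R}
    (hH : ∀ η ∈ H, ∀ ζ ∈ H, initSeg η n = initSeg ζ n → η = ζ)
    (hx : x ∈ treePiece a (H : Set (ℕ → K)) n) {A : Finset (Σ n : ℕ, (Fin n → K))}
    (hA : ∀ τ ∈ A, τ.1 < n) (hxA : ∀ τ, τ.1 < n → x τ ≠ 0 → τ ∈ A) :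
    x = ∑ η ∈ H, MulOpposite.op (x (initSeg η n)) • branchElt a η n +
      ∑ τ ∈ A, MulOpposite.op (x τ) • nodeElt R τ := by
  funext τ
  simp only [Pi.add_apply, Finset.sum_apply, Pi.smul_apply, op_smul_eq_mul]
  rcases lt_or_ge τ.1 n with h | h
  · rw [Finset.sum_eq_zero (fun η _ => by rw [branchElt_of_lt a η h, zero_mul]), zero_add]
    by_cases hτ : τ ∈ A
    · rw [Finset.sum_eq_single_of_mem τ hτ, nodeElt_self, one_mul]
      intro σ _ hne
      rw [nodeElt_of_ne hne.symm, zero_mul]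
    · rw [Finset.sum_eq_zero]
      · by_contra h0
        exact hτ (hxA τ h h0)
      · intro σ hσ
        rw [nodeElt_of_ne (by rintro rfl; exact hτ hσ), zero_mul]
  · rw [← apply_of_mem_treePiece a hH hx h, Finset.sum_eq_zero, add_zero]
    intro σ hσ
    rw [nodeElt_of_ne, zero_mul]
    rintro rfl
    have := hA _ hσ
    omega

/-- On a separated piece the coefficients in the generators are coordinates of the ambient product,
so they extend to functionals on the whole tree module. -/
theorem isLocallyProjective_treeModule : IsLocallyProjective R (TreeModule K a) := by
  classical
  intro s
  obtain ⟨H, n, hH, hs⟩ := exists_forall_mem_treePiece a s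
  have hfin : (⋃ x ∈ s, {τ : Σ n : ℕ, (Fin n → K) | τ.1 < n ∧ x.1 τ ≠ 0}).Finite :=
    s.finite_toSet.biUnion fun x hx => finite_of_mem_treePiece a (hs x hx)
  let A := hfin.toFinset
  refine ⟨(ℕ → K) ⊕ (Σ n : ℕ, (Fin n → K)), H.disjSum A,
    Sum.elim (fun η => ⟨_, branchElt_mem_treeModule a η n⟩)
      (fun τ => ⟨_, nodeElt_mem_treeModule a τ⟩),
    Sum.elim (fun η => LinearMap.proj (initSeg η n) ∘ₗ (TreeModule K a).subtype)
      (fun τ => LinearMap.proj τ ∘ₗ (TreeModule K a).subtype), fun x hx => ?_⟩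
  apply Subtype.ext
  rw [Finset.sum_disjSum, Submodule.coe_add, Submodule.coe_sum, Submodule.coe_sum]
  refine eq_sum_of_mem_treePiece a hH (hs x hx) (fun τ hτ => ?_) (fun τ h h' => ?_)
  · obtain ⟨y, -, hy⟩ := Set.mem_iUnion₂.1 (hfin.mem_toFinset.1 hτ)
    exact hy.1
  · exact hfin.mem_toFinset.2 (Set.mem_iUnion₂.2 ⟨x, hx, h, h'⟩)

lemma mem_nodeSpan_of_finite {x : (Σ n : ℕ, (Fin n → K)) → R} (hx : {τ | x τ ≠ 0}.Finite) :
    x ∈ nodeSpan K R := by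
  have : x = ∑ τ ∈ hx.toFinset, MulOpposite.op (x τ) • nodeElt R τ := by
    funext τ
    simp only [Finset.sum_apply, Pi.smul_apply, op_smul_eq_mul]
    by_cases h : x τ = 0
    · rw [h, Finset.sum_eq_zero]
      intro σ hσ
      rw [nodeElt_of_ne (by rintro rfl; exact (hx.mem_toFinset.1 hσ) h), zero_mul]
    · rw [Finset.sum_eq_single_of_mem τ (hx.mem_toFinset.2 h), nodeElt_self, one_mul]
      intro σ _ hne
      rw [nodeElt_of_ne hne.symm, zero_mul]
  rw [this]
  exact sum_mem fun τ _ => Submodule.smul_mem _ _ (Submodule.subset_span ⟨τ, rfl⟩)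

lemma nodeSpan_le_treeModule : nodeSpan K R ≤ TreeModule K a :=
  Submodule.span_mono Set.subset_union_left

/-- The germ at infinity of the restriction to the branch `η`. -/
noncomputable def branchGerm (R : Type u) [Ring R] (η : ℕ → K) :
    ((Σ n : ℕ, (Fin n → K)) → R) →ₗ[Rᵐᵒᵖ] ((ℕ → R) ⧸ eventuallyZero R) :=
  (eventuallyZero R).mkQ ∘ₗ LinearMap.funLeft Rᵐᵒᵖ R (initSeg η)

lemma branchGerm_eq_zero_iff {η : ℕ → K} {x : (Σ n : ℕ, (Fin n → K)) → R} :
    branchGerm R η x = 0 ↔ ∃ n, ∀ k ≥ n, x (initSeg η k) = 0 :=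
  Submodule.Quotient.mk_eq_zero _

lemma branchGerm_nodeElt (η : ℕ → K) (τ : Σ n : ℕ, (Fin n → K)) :
    branchGerm R η (nodeElt R τ) = 0 :=
  branchGerm_eq_zero_iff.2 ⟨τ.1 + 1, fun k hk => nodeElt_of_ne (by
    rintro rfl
    simp at hk)⟩

lemma branchGerm_of_mem_nodeSpan (η : ℕ → K) {x : (Σ n : ℕ, (Fin n → K)) → R}
    (hx : x ∈ nodeSpan K R) : branchGerm R η x = 0 := by
  have : nodeSpan K R ≤ LinearMap.ker (branchGerm R η) := by
    refine Submodule.span_le.2 ?_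
    rintro _ ⟨τ, rfl⟩
    exact branchGerm_nodeElt η τ
  exact this hx

lemma branchGerm_branchElt (η : ℕ → K) (n : ℕ) :
    branchGerm R η (branchElt a η n) = bassGen a n := by
  have : LinearMap.funLeft Rᵐᵒᵖ R (initSeg η) (branchElt a η n) = chainProd a n :=
    funext fun k => branchElt_initSeg a η n k
  rw [branchGerm, LinearMap.comp_apply, this]
  rfl

lemma branchGerm_branchElt_of_ne {η ζ : ℕ → K} (h : η ≠ ζ) (n : ℕ) :
    branchGerm R η (branchElt a ζ n) = 0 := by
  obtain ⟨i, hi⟩ := Function.ne_iff.1 h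
  refine branchGerm_eq_zero_iff.2 ⟨i + 1, fun k hk => branchElt_of_ne a fun h' => ?_⟩
  exact hi (initSeg_eq_iff.1 h' i (by simp; omega)).symm

lemma branchGerm_mem (η : ℕ → K) {x : (Σ n : ℕ, (Fin n → K)) → R} (hx : x ∈ TreeModule K a) :
    branchGerm R η x ∈ Bass a := by
  have : TreeModule K a ≤ (Bass a).comap (branchGerm R η) := by
    refine Submodule.span_le.2 ?_
    rintro _ (⟨τ, rfl⟩ | ⟨⟨ζ, n⟩, rfl⟩)
    · change branchGerm R η _ ∈ Bass a
      rw [branchGerm_nodeElt]; exact zero_mem _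
    · change branchGerm R η (branchElt a ζ n) ∈ Bass a
      by_cases h : η = ζ
      · rw [h, branchGerm_branchElt]; exact Subtype.mem _
      · rw [branchGerm_branchElt_of_ne a h]; exact zero_mem _
  exact this hx

/-- The projection of the tree module to the Bass module along the branch `η`. -/
noncomputable def branchProj (η : ℕ → K) : TreeModule K a →ₗ[Rᵐᵒᵖ] Bass a :=
  (branchGerm R η).restrict fun _ hx => branchGerm_mem a η hx

lemma coe_branchProj (η : ℕ → K) (x : TreeModule K a) :
    (branchProj a η x : (ℕ → R) ⧸ eventuallyZero R) = branchGerm R η x := rfl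

lemma branchProj_branchElt (η : ℕ → K) (n : ℕ) :
    branchProj a η ⟨_, branchElt_mem_treeModule a η n⟩ = bassGen a n :=
  Subtype.ext (branchGerm_branchElt a η n)

lemma branchProj_branchElt_of_ne {η ζ : ℕ → K} (h : η ≠ ζ) (n : ℕ) :
    branchProj a η ⟨_, branchElt_mem_treeModule a ζ n⟩ = 0 :=
  Subtype.ext (branchGerm_branchElt_of_ne a h n)

lemma branchProj_of_mem_nodeSpan (η : ℕ → K) {x : TreeModule K a}
    (hx : (x : (Σ n : ℕ, (Fin n → K)) → R) ∈ nodeSpan K R) : branchProj a η x = 0 :=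
  Subtype.ext (branchGerm_of_mem_nodeSpan η hx)

lemma finite_branchProj_ne_zero (x : TreeModule K a) : {η | branchProj a η x ≠ 0}.Finite := by
  obtain ⟨x, hx⟩ := x
  induction hx using Submodule.span_induction with
  | mem x hx =>
    rcases hx with ⟨τ, rfl⟩ | ⟨⟨ζ, n⟩, rfl⟩
    · refine Set.finite_empty.subset fun η hη => hη (Subtype.ext (branchGerm_nodeElt η τ))
    · refine (Set.finite_singleton ζ).subset fun η hη => ?_
      by_contra h
      exact hη (branchProj_branchElt_of_ne a h n)
  | zero => exact Set.finite_empty.subset fun η hη => hη (map_zero _)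
  | add x y hx hy ihx ihy =>
    refine (ihx.union ihy).subset fun η hη => ?_
    by_contra h
    simp only [Set.mem_union, Set.mem_ofPred_eq, not_or, not_not] at h
    refine hη (((branchProj a η).map_add ⟨x, hx⟩ ⟨y, hy⟩).trans ?_)
    rw [h.1, h.2, add_zero]
  | smul c x hx ih =>
    refine ih.subset fun η hη h => hη (((branchProj a η).map_smul c ⟨x, hx⟩).trans ?_)
    rw [h, smul_zero]

/-- The projection of the tree module to the direct sum of the Bass modules of all branches. -/
noncomputable def treeProj (K : Type u) : TreeModule K a →ₗ[Rᵐᵒᵖ] ((ℕ → K) →₀ Bass a) where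
  toFun x := Finsupp.ofSupportFinite (fun η => branchProj a η x) (finite_branchProj_ne_zero a x)
  map_add' x y := Finsupp.ext fun η => map_add (branchProj a η) x y
  map_smul' c x := Finsupp.ext fun η => map_smul (branchProj a η) c x

lemma treeProj_apply (x : TreeModule K a) (η : ℕ → K) : treeProj a K x η = branchProj a η x := rfl

lemma treeProj_surjective : Function.Surjective (treeProj a K) := by
  rw [← LinearMap.range_eq_top, eq_top_iff]
  rintro m -
  rw [← m.sum_single]
  refine Submodule.sum_mem _ fun η _ => ?_
  obtain ⟨k, hk⟩ := exists_eq_smul_bassGen a (m η)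
  obtain ⟨r, hr⟩ := hk k le_rfl
  refine ⟨MulOpposite.op r • ⟨_, branchElt_mem_treeModule a η k⟩, Finsupp.ext fun ζ => ?_⟩
  rw [treeProj_apply, map_smul, hr]
  by_cases h : ζ = η
  · rw [h, branchProj_branchElt, Finsupp.single_eq_same]
  · rw [branchProj_branchElt_of_ne a h, smul_zero, Finsupp.single_eq_of_ne h]

/-- Expand x in a separated piece. Along η, x eventually agrees with its η-term, so a vanishing germ
leaves that term with finite support. -/
lemma mem_nodeSpan_of_treeProj_eq_zero {x : TreeModule K a} (hx : treeProj a K x = 0) :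
    (x : (Σ n : ℕ, (Fin n → K)) → R) ∈ nodeSpan K R := by
  classical
  obtain ⟨H, n, hH, hs⟩ := exists_forall_mem_treePiece a {x}
  have hxm := hs x (Finset.mem_singleton_self x)
  have hfin := finite_of_mem_treePiece a hxm
  rw [eq_sum_of_mem_treePiece a hH hxm (A := hfin.toFinset)
    (fun τ hτ => (hfin.mem_toFinset.1 hτ).1) (fun τ h h' => hfin.mem_toFinset.2 ⟨h, h'⟩)]
  refine add_mem (sum_mem fun η hη => ?_)
    (sum_mem fun τ _ => Submodule.smul_mem _ _ (Submodule.subset_span ⟨τ, rfl⟩))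
  have h0 : branchGerm R η x = 0 := by
    rw [← coe_branchProj a η x, ← treeProj_apply, hx]; rfl
  obtain ⟨k, hk⟩ := branchGerm_eq_zero_iff.1 h0
  refine mem_nodeSpan_of_finite ((Set.finite_Iio (max n k)).image (initSeg η) |>.subset ?_)
  intro τ hτ
  rw [Set.mem_ofPred_eq, Pi.smul_apply, op_smul_eq_mul] at hτ
  have h1 : initSeg η τ.1 = τ := by
    by_contra h
    exact hτ (by rw [branchElt_of_ne a h, zero_mul])
  refine ⟨τ.1, ?_, h1⟩
  by_contra h
  rw [Set.mem_Iio, not_lt] at h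
  have h2 := apply_of_mem_treePiece a hH hxm (τ := τ) ((le_max_left _ _).trans h)
  rw [← h1, hk _ ((le_max_right _ _).trans h), Finset.sum_eq_single_of_mem η hη] at h2
  · exact hτ (by rw [← h1]; exact h2.symm)
  · intro ζ hζ hne
    rw [branchElt_of_ne, zero_mul]
    intro h3
    have h4 : n ≤ τ.1 := (le_max_left _ _).trans h
    exact hne (hH _ hζ _ hη (initSeg_eq_iff.2 fun i hi =>
      initSeg_eq_iff.1 h3 i (by simp; omega)))

end Tree

end FlatML

namespace FlatML

/-! ### Sets with many more branches than nodes -/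

section Cardinality

/-- Iterated power sets. -/
def iteratedPower (A : Type u) : ℕ → Type u
  | 0 => A
  | n + 1 => Set (iteratedPower A n)

/-- K is the disjoint union of the iterated power sets of A ⊕ ℕ. A subset of K is the sequence of
its slices, and the n-th slice is an element of the (n+1)-st summand, so the subsets of K inject
into ℕ → K. -/
lemma exists_large_type (A : Type u) : ∃ K : Type u, Cardinal.mk A ≤ Cardinal.mk K ∧
    Cardinal.aleph0 ≤ Cardinal.mk K ∧ 2 ^ Cardinal.mk K ≤ Cardinal.mk (ℕ → K) := by
  let B := A ⊕ ULift.{u} ℕ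
  have hmk : ∀ n, Function.Injective
      (fun x : iteratedPower B n => (⟨n, x⟩ : Σ n, iteratedPower B n)) :=
    fun n => sigma_mk_injective
  refine ⟨Σ n, iteratedPower B n, ?_, ?_, ?_⟩
  · refine Cardinal.mk_le_of_injective (f := fun x => ⟨0, (Sum.inl x : B)⟩) fun x y h =>
      Sum.inl_injective (hmk 0 h)
  · rw [Cardinal.aleph0_le_mk_iff]
    refine Infinite.of_injective (fun n : ℕ => (⟨0, (Sum.inr ⟨n⟩ : B)⟩ : Σ n, iteratedPower B n))
      fun x y h => ULift.up_injective (Sum.inr_injective (hmk 0 h))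
  · rw [← Cardinal.mk_set]
    refine Cardinal.mk_le_of_injective (f := fun (S : Set (Σ n, iteratedPower B n)) (n : ℕ) =>
      (⟨n + 1, ({x | (⟨n, x⟩ : Σ n, iteratedPower B n) ∈ S} : Set (iteratedPower B n))⟩ :
        Σ n, iteratedPower B n)) fun S T h => ?_
    ext ⟨n, x⟩
    exact Set.ext_iff.1 (hmk (n + 1) (congrFun h n)) x

lemma mk_tree_le {K : Type u} (hK : Cardinal.aleph0 ≤ Cardinal.mk K) :
    Cardinal.mk (Σ n : ℕ, (Fin n → K)) ≤ Cardinal.mk K := by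
  have : Infinite K := Cardinal.aleph0_le_mk_iff.1 hK
  rw [← Cardinal.mk_list_eq_mk K]
  exact (Cardinal.mk_congr List.equivSigmaTuple.symm).le

end Cardinality

/-! ### Counting extensions: no cotorsion pair -/

section Cotorsion

variable {K R : Type u} [Ring R] (a : ℕ → R)

/-- The short complex `0 → R^(T) → L → B^(Br) → 0` of the tree module `L`. -/
noncomputable def treeComplex (K : Type u) : ShortComplex (ModuleCat.{u} Rᵐᵒᵖ) :=
  ShortComplex.mk (X₁ := ModuleCat.of Rᵐᵒᵖ (nodeSpan K R))
    (X₂ := ModuleCat.of Rᵐᵒᵖ (TreeModule K a))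
    (X₃ := ModuleCat.of Rᵐᵒᵖ ((ℕ → K) →₀ Bass a))
    (ModuleCat.ofHom (Submodule.inclusion (nodeSpan_le_treeModule a)))
    (ModuleCat.ofHom (treeProj a K))
    (by
      ext1
      exact LinearMap.ext fun x => Finsupp.ext fun η => branchProj_of_mem_nodeSpan a η x.2)

lemma treeComplex_shortExact : (treeComplex a K).ShortExact where
  exact := by
    rw [ShortComplex.moduleCat_exact_iff]
    intro x hx
    exact ⟨⟨_, mem_nodeSpan_of_treeProj_eq_zero a (x := x) hx⟩, rfl⟩
  mono_f := (ModuleCat.mono_iff_injective _).2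
    (Submodule.inclusion_injective (nodeSpan_le_treeModule a))
  epi_g := (ModuleCat.epi_iff_surjective _).2 (treeProj_surjective a)

lemma nodeSpan_hom_ext {N : Type*} [AddCommGroup N] [Module Rᵐᵒᵖ N]
    {f g : nodeSpan K R →ₗ[Rᵐᵒᵖ] N}
    (h : ∀ τ, f ⟨nodeElt R τ, Submodule.subset_span ⟨τ, rfl⟩⟩ =
      g ⟨nodeElt R τ, Submodule.subset_span ⟨τ, rfl⟩⟩) : f = g := by
  ext ⟨x, hx⟩
  induction hx using Submodule.span_induction with
  | mem x hx => obtain ⟨τ, rfl⟩ := hx; exact h τ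
  | zero => exact (map_zero f).trans (map_zero g).symm
  | add x y hx hy ihx ihy =>
    exact (f.map_add ⟨x, hx⟩ ⟨y, hy⟩).trans ((congrArg₂ _ ihx ihy).trans (g.map_add _ _).symm)
  | smul c x hx ih =>
    exact (f.map_smul c ⟨x, hx⟩).trans ((congrArg _ ih).trans (g.map_smul _ _).symm)

open Classical in
/-- The sum over the branches in `J`. -/
noncomputable def partialSum (a : ℕ → R) (J : Set (ℕ → K)) :
    ModuleCat.of Rᵐᵒᵖ ((ℕ → K) →₀ Bass a) ⟶ ModuleCat.of Rᵐᵒᵖ (Bass a) :=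
  ModuleCat.ofHom (Finsupp.lsum ℕ fun η => if η ∈ J then LinearMap.id else 0)

/-- The inclusion of the summand with index `η`. -/
noncomputable def branchIncl (a : ℕ → R) (η : ℕ → K) :
    ModuleCat.of Rᵐᵒᵖ (Bass a) ⟶ ModuleCat.of Rᵐᵒᵖ ((ℕ → K) →₀ Bass a) :=
  ModuleCat.ofHom (Finsupp.lsingle η)

open Classical in
lemma branchIncl_comp_partialSum (a : ℕ → R) (J : Set (ℕ → K)) (η : ℕ → K) :
    branchIncl a η ≫ partialSum a J = if η ∈ J then 𝟙 _ else 0 := by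
  ext1
  refine LinearMap.ext fun x => ?_
  change (Finsupp.lsum ℕ fun η => if η ∈ J then LinearMap.id else 0)
    (Finsupp.single η x) = _
  rw [Finsupp.lsum_single]
  split_ifs <;> rfl

-- The set J is recovered from the pulled-back class: restricted to the summand of η it is ξ if η ∈
-- J and 0 otherwise.
open Abelian in
lemma partialSum_comp_injective {N : ModuleCat.{u} Rᵐᵒᵖ}
    (ξ : Ext.{u} (ModuleCat.of Rᵐᵒᵖ (Bass a)) N 1) (hξ : ξ ≠ 0) :
    Function.Injective fun J : Set (ℕ → K) =>
      (Ext.mk₀ (partialSum a J)).comp ξ (zero_add 1) := by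
  classical
  have key : ∀ (J : Set (ℕ → K)) (η : ℕ → K),
      (Ext.mk₀ (branchIncl a η)).comp
        ((Ext.mk₀ (partialSum a J)).comp ξ (zero_add 1)) (zero_add 1) =
        if η ∈ J then ξ else 0 := by
    intro J η
    rw [Ext.mk₀_comp_mk₀_assoc, branchIncl_comp_partialSum]
    split_ifs
    · rw [Ext.mk₀_id_comp]
    · rw [Ext.mk₀_zero, Ext.zero_comp]
  intro J J' h
  ext η
  have h1 := key J η
  have h2 := key J' η
  dsimp only at h
  rw [h, h2] at h1
  by_cases hJ : η ∈ J <;> by_cases hJ' : η ∈ J' <;> simp_all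

-- With Ext¹(L, N) = 0, every pulled-back class comes from a homomorphism on the node span, which is
-- determined by its values on nodes. There are at most |N|^|T| ≤ |K|^|K| = 2^|K| ≤ |branches| of
-- these, fewer than the sets of branches by Cantor.
open Abelian in
theorem subsingleton_ext_bass {N : ModuleCat.{u} Rᵐᵒᵖ} (hN : ∀ K : Type u, Subsingleton
    (Ext.{u} (ModuleCat.of Rᵐᵒᵖ (TreeModule K a)) N 1)) :
    Subsingleton (Ext.{u} (ModuleCat.of Rᵐᵒᵖ (Bass a)) N 1) := by
  by_contra hB
  rw [not_subsingleton_iff_nontrivial] at hB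
  obtain ⟨ξ, hξ⟩ := exists_ne (0 : Ext.{u} (ModuleCat.of Rᵐᵒᵖ (Bass a)) N 1)
  obtain ⟨K, hNK, hK, hpow⟩ := exists_large_type N
  have hlift : ∀ J : Set (ℕ → K), ∃ f : nodeSpan K R →ₗ[Rᵐᵒᵖ] N,
      (treeComplex_shortExact a (K := K)).extClass.comp (Ext.mk₀ (ModuleCat.ofHom f)) (add_zero 1) =
        (Ext.mk₀ (partialSum a J)).comp ξ (zero_add 1) := by
    intro J
    have hsub := hN K
    obtain ⟨x, hx⟩ := Ext.contravariant_sequence_exact₃ (treeComplex_shortExact a (K := K)) N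
      ((Ext.mk₀ (partialSum a J)).comp ξ (zero_add 1))
      (@Subsingleton.elim _ hsub _ _) (add_zero 1)
    obtain ⟨f, rfl⟩ := (Ext.mk₀_bijective _ _).2 x
    exact ⟨f.hom, hx⟩
  choose f hf using hlift
  have hinj : Function.Injective fun (J : Set (ℕ → K)) (τ : Σ n : ℕ, (Fin n → K)) =>
      f J ⟨nodeElt R τ, Submodule.subset_span ⟨τ, rfl⟩⟩ := by
    intro J J' h
    apply partialSum_comp_injective a ξ hξ
    dsimp only
    rw [← hf, ← hf, nodeSpan_hom_ext fun τ => congrFun h τ]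
  have h1 := Cardinal.mk_le_of_injective hinj
  rw [Cardinal.mk_set] at h1
  have h2 : Cardinal.mk ((Σ n : ℕ, (Fin n → K)) → N) ≤ Cardinal.mk (ℕ → K) := by
    rw [← Cardinal.power_def]
    have hK1 : 1 ≤ Cardinal.mk K := Cardinal.one_le_aleph0.trans hK
    calc Cardinal.mk N ^ Cardinal.mk (Σ n : ℕ, (Fin n → K))
        ≤ Cardinal.mk K ^ Cardinal.mk (Σ n : ℕ, (Fin n → K)) := Cardinal.power_le_power_right hNK
      _ ≤ Cardinal.mk K ^ Cardinal.mk K :=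
        Cardinal.power_le_power_left (by rintro h; simp [h] at hK1) (mk_tree_le hK)
      _ = 2 ^ Cardinal.mk K := Cardinal.power_self_eq hK
      _ ≤ _ := hpow
  exact absurd (h1.trans h2) (not_le.2 (Cardinal.cantor _))

lemma treeModule_mem (K : Type u) : flatMittagLeffler R (ModuleCat.of Rᵐᵒᵖ (TreeModule K a)) :=
  (flatMittagLeffler_iff _).2 (isLocallyProjective_treeModule a).hasContents

lemma isStationary_of_bass_mem (h : flatMittagLeffler R (ModuleCat.of Rᵐᵒᵖ (Bass a))) :
    IsStationary a :=
  isStationary_of_hasContents ((flatMittagLeffler_iff _).1 h) LinearMap.id (bassGen a 0) rfl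
    fun n => ⟨bassGen a n, bassGen_eq_smul a (Nat.zero_le n)⟩

theorem isStationary_of_isCotorsionPair {ℬ : ObjectProperty (ModuleCat.{u} Rᵐᵒᵖ)}
    (h : IsCotorsionPair (flatMittagLeffler R) ℬ) : IsStationary a := by
  apply isStationary_of_bass_mem
  have hL := fun K : Type u => treeModule_mem (R := R) a K
  rw [h.1] at hL ⊢
  exact fun N hN => subsingleton_ext_bass a fun K => hL K N hN

end Cotorsion

end FlatML

namespace FlatML

/-! ### Cardinality of spans and unions -/

section SmallSpan

variable {S : Type u} [Ring S] {M : Type u} [AddCommGroup M] [Module S M]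

open Cardinal

lemma mk_finsupp_le {X : Type u} {c : Cardinal.{u}} (hc : ℵ₀ ≤ c) (hS : #S ≤ c) (hX : #X ≤ c) :
    #(X →₀ S) ≤ c := by
  classical
  calc #(X →₀ S) ≤ #(Finset (X × S)) := mk_le_of_injective (Finsupp.graph_injective X S)
    _ ≤ #(List (X × S)) := mk_le_of_surjective List.toFinset_surjective
    _ ≤ max ℵ₀ #(X × S) := mk_list_le_max _
    _ ≤ c := max_le hc (by
      rw [mk_prod, lift_id, lift_id]
      exact (mul_le_mul' hX hS).trans (mul_eq_self hc).le)

lemma mk_span_le {X : Set M} {c : Cardinal.{u}} (hc : ℵ₀ ≤ c) (hS : #S ≤ c) (hX : #X ≤ c) :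
    #(Submodule.span S X) ≤ c := by
  have h := fun x => Finsupp.mem_span_iff_linearCombination S X x
  refine le_trans (mk_le_of_surjective (f := fun z : X →₀ S =>
    (⟨Finsupp.linearCombination S Subtype.val z, (h _).2 ⟨z, rfl⟩⟩ : Submodule.span S X)) ?_)
    (mk_finsupp_le hc hS hX)
  rintro ⟨x, hx⟩
  obtain ⟨z, hz⟩ := (h x).1 hx
  exact ⟨z, Subtype.ext hz⟩

lemma mk_biUnion_le_of_le {ι N : Type u} {X : Set ι} {c : Cardinal.{u}} (hc : ℵ₀ ≤ c) (hX : #X ≤ c)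
    {f : ι → Set N} (hf : ∀ i ∈ X, #(f i) ≤ c) : #(⋃ i ∈ X, f i : Set N) ≤ c :=
  (mk_biUnion_le f X).trans
    ((mul_le_mul' hX (ciSup_le' fun i : X => hf i i.2)).trans (mul_eq_self hc).le)

lemma mk_finset_biUnion_le {N : Type u} {ι : Type*} (s : Finset ι) {c : Cardinal.{u}} (hc : ℵ₀ ≤ c)
    {f : ι → Set N} (hf : ∀ i ∈ s, #(f i) ≤ c) : #(⋃ i ∈ s, f i : Set N) ≤ c := by
  classical
  induction s using Finset.induction_on with
  | empty => simp
  | insert a s _ ih =>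
    rw [Finset.set_biUnion_insert]
    exact (mk_union_le _ _).trans (add_le_of_le hc (hf a (Finset.mem_insert_self a s))
      (ih fun i hi => hf i (Finset.mem_insert_of_mem hi)))

end SmallSpan

/-! ### Small submodules compatible with a filtration -/

section Hill

variable {S : Type u} [Ring S] {L : Type u} [AddCommGroup L] [Module S L] {l : Ordinal.{u}}
  {F : Ordinal.{u} → Submodule S L}

open Cardinal

lemma IsFiltration.le_iSup_Iio (hF : IsFiltration l F) {A : Ordinal.{u} → Submodule S L}
    (hA : ∀ α < l, F (Order.succ α) ≤ F α ⊔ A α) : ∀ α ≤ l, F α ≤ ⨆ β : Set.Iio α, A β := by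
  intro α
  induction α using Ordinal.limitRecOn with
  | zero => intro _; rw [hF.zero]; exact bot_le
  | add_one α ih =>
    rw [← Order.succ_eq_add_one]
    intro h
    have hα : α < l := (Order.lt_succ α).trans_le h
    refine (hA α hα).trans (sup_le ((ih hα.le).trans (iSup_le fun β => ?_)) ?_)
    · exact le_iSup (fun β : Set.Iio (Order.succ α) => A β)
        ⟨β, (show β.1 < α from β.2).trans (Order.lt_succ α)⟩
    · exact le_iSup (fun β : Set.Iio (Order.succ α) => A β) ⟨α, Order.lt_succ α⟩
  | limit α hlim ih =>
    intro h x hx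
    have hx' : x ∈ (F α : Set L) := hx
    rw [hF.limit α h hlim] at hx'
    simp only [Set.mem_iUnion] at hx'
    obtain ⟨β, hβ, hx'⟩ := hx'
    refine (ih β hβ (hβ.le.trans h)).trans (iSup_le fun γ => ?_) hx'
    exact le_iSup (fun β : Set.Iio α => A β) ⟨γ, (show γ.1 < β from γ.2).trans hβ⟩

/-- The support is taken below the least index whose term contains x, so it is bounded by every
index with this property at once. -/
lemma IsFiltration.exists_supports (hF : IsFiltration l F) {A : Ordinal.{u} → Submodule S L}
    (hA : ∀ α < l, F (Order.succ α) ≤ F α ⊔ A α) (x : L) :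
    ∃ s : Finset Ordinal.{u}, x ∈ ⨆ β ∈ s, A β ∧ ∀ β ∈ s, β < l ∧
      ∀ α ≤ l, x ∈ F α → β < α := by
  classical
  have hne : {α | α ≤ l ∧ x ∈ F α}.Nonempty := ⟨l, le_rfl, by rw [hF.top]; trivial⟩
  obtain ⟨hα, hx⟩ := csInf_mem hne
  set α := sInf {α | α ≤ l ∧ x ∈ F α}
  obtain ⟨s, hs⟩ := Submodule.mem_iSup_iff_exists_finset.1 (hF.le_iSup_Iio hA α hα hx)
  refine ⟨s.image Subtype.val, ?_, fun β hβ => ?_⟩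
  · refine (iSup₂_le fun γ hγ => ?_ : ⨆ γ ∈ s, A γ ≤ _) hs
    exact le_iSup₂_of_le γ.1 (Finset.mem_image_of_mem _ hγ) le_rfl
  · obtain ⟨γ, -, rfl⟩ := Finset.mem_image.1 hβ
    have hγ : γ.1 < α := γ.2
    exact ⟨hγ.trans_le hα, fun δ hδ h => hγ.trans_le (csInf_le' ⟨hδ, h⟩)⟩

lemma exists_small_closed {c : Cardinal.{u}} (hc : ℵ₀ ≤ c) (hS : #S ≤ c) {X : Set L}
    (hX : #X ≤ c) (f : L → Set L) (hf : ∀ x, #(f x) ≤ c) :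
    ∃ P : Submodule S L, X ⊆ P ∧ #P ≤ c ∧ ∀ x ∈ P, f x ⊆ P := by
  let step : Submodule S L → Submodule S L := fun P =>
    Submodule.span S ((P : Set L) ∪ ⋃ x ∈ (P : Set L), f x)
  let Q : ℕ → Submodule S L := fun n => step^[n] (Submodule.span S X)
  have hQs : ∀ n, Q (n + 1) = step (Q n) := fun n => Function.iterate_succ_apply' _ _ _
  have hQ : Monotone Q := monotone_nat_of_le_succ fun n => by
    rw [hQs]
    exact fun x hx => Submodule.subset_span (Or.inl hx)
  have hQc : ∀ n, #(Q n) ≤ c := by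
    intro n
    induction n with
    | zero => exact mk_span_le hc hS hX
    | succ n ih =>
      rw [hQs]
      exact mk_span_le hc hS ((mk_union_le _ _).trans (add_le_of_le hc ih
        (mk_biUnion_le_of_le hc ih fun x _ => hf x)))
  have hmem : ∀ x, x ∈ ⨆ n, Q n ↔ ∃ n, x ∈ Q n := Submodule.mem_iSup_of_chain ⟨Q, hQ⟩
  refine ⟨⨆ n, Q n, fun x hx => (hmem x).2 ⟨0, Submodule.subset_span hx⟩, ?_, fun x hx y hy => ?_⟩
  · have : ((⨆ n, Q n : Submodule S L) : Set L) = ⋃ n, (Q n : Set L) :=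
      Submodule.coe_iSup_of_chain ⟨Q, hQ⟩
    change #((⨆ n, Q n : Submodule S L) : Set L) ≤ c
    rw [this]
    have h1 := mk_iUnion_le_lift fun n => (Q n : Set L)
    rw [lift_uzero, mk_nat, lift_aleph0] at h1
    simp only [lift_id'] at h1
    refine h1.trans ((mul_le_mul' hc (ciSup_le' fun n => ?_)).trans (mul_eq_self hc).le)
    simpa using hQc n
  · obtain ⟨n, hn⟩ := (hmem x).1 hx
    refine (hmem y).2 ⟨n + 1, ?_⟩
    rw [hQs]
    exact Submodule.subset_span (Or.inr (Set.mem_iUnion₂.2 ⟨x, hn, hy⟩))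

/-- A case of the Hill lemma. -/
theorem IsFiltration.exists_small_submodule (hF : IsFiltration l F) {c : Cardinal.{u}}
    (hc : ℵ₀ ≤ c) (hS : #S ≤ c) {A : Ordinal.{u} → Submodule S L}
    (hA : ∀ α < l, F (Order.succ α) ≤ F α ⊔ A α) (hA' : ∀ α < l, A α ≤ F (Order.succ α))
    (hAc : ∀ α < l, #(A α) ≤ c) {X : Set L}
    (hX : #X ≤ c) : ∃ P : Submodule S L, X ⊆ P ∧ #P ≤ c ∧ ∀ α < l,
      F (Order.succ α) ≤ F α ⊔ P ∨ F (Order.succ α) ⊓ P ≤ F α := by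
  choose s hs hs' using hF.exists_supports hA
  -- Close P under passing from an element to all A β with β in its chosen support.
  obtain ⟨P, hXP, hPc, hP⟩ := exists_small_closed hc hS hX
    (fun x => ⋃ β ∈ s x, (A β : Set L))
    (fun x => mk_finset_biUnion_le _ hc fun β hβ => hAc β (hs' x β hβ).1)
  refine ⟨P, hXP, hPc, fun α hα => or_iff_not_imp_right.2 fun h => ?_⟩
  obtain ⟨z, ⟨hzF, hzP⟩, hz⟩ := SetLike.not_le_iff_exists.1 h
  -- Since z lies in F (α + 1), its support is bounded by α; if α were missing, z would be a sum
  -- from the A β with β < α and would lie in F α.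
  have hαs : α ∈ s z := by
    by_contra hαs
    refine hz ((iSup₂_le fun β hβ => ?_ : ⨆ β ∈ s z, A β ≤ F α) (hs z))
    obtain ⟨hβl, hβ'⟩ := hs' z β hβ
    have h1 := Order.lt_succ_iff.1 (hβ' _ (Order.succ_le_of_lt hα) hzF)
    have h2 : β < α := lt_of_le_of_ne h1 (by rintro rfl; exact hαs hβ)
    exact (hA' β hβl).trans (hF.mono _ _ (Order.succ_le_of_lt h2) hα.le)
  refine (hA α hα).trans (sup_le_sup_left (fun x hx => hP z hzP ?_) _)
  exact Set.mem_iUnion₂.2 ⟨α, hαs, hx⟩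

end Hill

end FlatML

namespace FlatML

/-! ### Filtrations modulo a submodule -/

section QuotientFiltration

variable {S : Type u} [Ring S] {L : Type u} [AddCommGroup L] [Module S L] {l : Ordinal.{u}}
  {F : Ordinal.{u} → Submodule S L}

lemma IsFiltration.map_mkQ (hF : IsFiltration l F) (P : Submodule S L) :
    IsFiltration l fun α => (F α).map P.mkQ where
  zero := by rw [hF.zero, Submodule.map_bot]
  top := by rw [hF.top, Submodule.map_top, Submodule.range_mkQ]
  mono α β h h' := Submodule.map_mono (hF.mono α β h h')
  limit α h h' := by
    simp only [Submodule.map_coe]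
    rw [hF.limit α h h', Set.image_iUnion₂]

/-- If `B ⊓ P ≤ A`, the section `B / A` is isomorphic to the corresponding section of the images
modulo `P`. -/
lemma nonempty_quotient_map_mkQ_equiv {A B P : Submodule S L} (hAB : A ≤ B) (h : B ⊓ P ≤ A) :
    Nonempty (((B.map P.mkQ) ⧸ (A.map P.mkQ).submoduleOf (B.map P.mkQ)) ≃ₗ[S]
      (B ⧸ A.submoduleOf B)) := by
  let g : B →ₗ[S] B.map P.mkQ := P.mkQ.restrict fun x hx => Submodule.mem_map_of_mem hx
  have hg : Function.Surjective g := by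
    rintro ⟨_, ⟨x, hx, rfl⟩⟩
    exact ⟨⟨x, hx⟩, rfl⟩
  let ψ := ((A.map P.mkQ).submoduleOf (B.map P.mkQ)).mkQ ∘ₗ g
  have hψ : Function.Surjective ψ := (Submodule.mkQ_surjective _).comp hg
  have hker : LinearMap.ker ψ = A.submoduleOf B := by
    ext ⟨x, hx⟩
    rw [LinearMap.mem_ker, LinearMap.comp_apply, Submodule.mkQ_apply,
      Submodule.Quotient.mk_eq_zero]
    constructor
    · rintro ⟨y, hy, hxy⟩
      have hxy : P.mkQ y = P.mkQ x := hxy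
      have h1 : x - y ∈ P := (Submodule.Quotient.eq P).1 hxy.symm
      have h2 : x - y ∈ A := h ⟨sub_mem hx (hAB hy), h1⟩
      have h3 := add_mem h2 hy
      rw [sub_add_cancel] at h3
      exact h3
    · intro hxA
      exact ⟨x, hxA, rfl⟩
  exact ⟨((Submodule.quotEquivOfEq _ _ hker).symm.trans
    (ψ.quotKerEquivOfSurjective hψ)).symm⟩

lemma IsLTPresented.exists_generators {κ c : Cardinal.{u}} (hc : Cardinal.aleph0 ≤ c)
    (hκ : κ ≤ c) (hS : Cardinal.mk S ≤ c) {A B : Submodule S L}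
    (h : IsLTPresented (S := S) κ (B ⧸ A.submoduleOf B)) :
    ∃ G : Submodule S L, B ≤ A ⊔ G ∧ G ≤ B ∧ Cardinal.mk G ≤ c := by
  obtain ⟨X, f, -, hX, hf, -, -⟩ := h
  choose g hg using fun x : X => Submodule.mkQ_surjective _ (f (Finsupp.single x 1))
  refine ⟨Submodule.span S (Set.range fun x => (g x : L)), fun b hb => ?_,
    Submodule.span_le.2 ?_, mk_span_le hc hS (Cardinal.mk_range_le.trans (hX.le.trans hκ))⟩
  · obtain ⟨z, hz⟩ := hf ((A.submoduleOf B).mkQ ⟨b, hb⟩)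
    have h1 : f = (A.submoduleOf B).mkQ ∘ₗ Finsupp.linearCombination S g := by
      ext x
      simpa using (hg x).symm
    rw [h1, LinearMap.comp_apply] at hz
    have h2 := (Submodule.Quotient.eq _).1 hz.symm
    have h3 : b - (Finsupp.linearCombination S g z : B) ∈ A := h2
    have h4 : ((Finsupp.linearCombination S g z : B) : L) =
        Finsupp.linearCombination S (fun x => (g x : L)) z := by
      simp [Finsupp.linearCombination_apply, Finsupp.sum]
    rw [← sub_add_cancel b ((Finsupp.linearCombination S g z : B) : L)]
    refine add_mem (Submodule.mem_sup_left h3) (Submodule.mem_sup_right ?_)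
    rw [h4, ← Finsupp.range_linearCombination]
    exact ⟨z, rfl⟩
  · rintro _ ⟨x, rfl⟩
    exact (g x).2

lemma IsLTPresented.of_linearEquiv {κ : Cardinal.{u}} {M N : Type u} [AddCommGroup M] [Module S M]
    [AddCommGroup N] [Module S N] (h : IsLTPresented (S := S) κ M) (e : M ≃ₗ[S] N) :
    IsLTPresented (S := S) κ N := by
  obtain ⟨X, f, Y, hX, hf, hY, hspan⟩ := h
  refine ⟨X, e.toLinearMap ∘ₗ f, Y, hX, e.surjective.comp hf, hY, ?_⟩
  rw [hspan, LinearMap.ker_comp, LinearEquiv.ker, Submodule.comap_bot]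

end QuotientFiltration

/-! ### Deconstructibility forces stationarity -/

section Deconstruction

variable {R : Type u} [Ring R] (a : ℕ → R)

lemma hasContents_of_subsingleton {M : Type u} [AddCommGroup M] [Module Rᵐᵒᵖ M] [Subsingleton M] :
    HasContents (⊤ : Submodule Rᵐᵒᵖ M) := fun X 𝒩 m _ _ => by
  rw [Subsingleton.elim m 0]; exact zero_mem _

/-- For the P of the Hill lemma, the image filtration of L/P has each factor either zero or
isomorphic to the original one, so L/P is again a transfinite extension of modules with contents. -/
theorem exists_small_submodule_hasContents_quotient (h : IsDeconstructible (flatMittagLeffler R)) :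
    ∃ κ : Cardinal.{u}, ∀ (L : Type u) [AddCommGroup L] [Module Rᵐᵒᵖ L],
      HasContents (⊤ : Submodule Rᵐᵒᵖ L) → ∀ (c : Cardinal.{u}), Cardinal.aleph0 ≤ c → κ ≤ c →
      Cardinal.mk R ≤ c → ∀ X : Set L, Cardinal.mk X ≤ c → ∃ P : Submodule Rᵐᵒᵖ L, X ⊆ P ∧
        Cardinal.mk P ≤ c ∧ HasContents (⊤ : Submodule Rᵐᵒᵖ (L ⧸ P)) := by
  obtain ⟨κ, -, hκ⟩ := h
  refine ⟨κ, fun L _ _ hL c hc hκc hR X hX => ?_⟩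
  obtain ⟨l, F, hF, hA⟩ := hκ (ModuleCat.of Rᵐᵒᵖ L) ((flatMittagLeffler_iff _).2 hL)
  have hR' : Cardinal.mk Rᵐᵒᵖ ≤ c := by
    rwa [← Cardinal.mk_congr (MulOpposite.opEquiv (α := R))]
  have hmono : ∀ α < l, F α ≤ F (Order.succ α) := fun α hα =>
    hF.mono _ _ (Order.le_succ α) (Order.succ_le_of_lt hα)
  have hG : ∀ α, ∃ G : Submodule Rᵐᵒᵖ L, α < l → F (Order.succ α) ≤ F α ⊔ G ∧
      G ≤ F (Order.succ α) ∧ Cardinal.mk G ≤ c := by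
    intro α
    by_cases hα : α < l
    · obtain ⟨A, hA, ⟨e⟩⟩ := hA α hα
      obtain ⟨G, hG⟩ := (hA.2.of_linearEquiv e.symm).exists_generators hc hκc hR'
      exact ⟨G, fun _ => hG⟩
    · exact ⟨⊥, fun h => (hα h).elim⟩
  choose G hG using hG
  obtain ⟨P, hXP, hPc, hP⟩ := hF.exists_small_submodule hc hR' (A := G) (fun α hα => (hG α hα).1)
    (fun α hα => (hG α hα).2.1) (fun α hα => (hG α hα).2.2) hX
  refine ⟨P, hXP, hPc, (hF.map_mkQ P).hasContents fun α hα => ?_⟩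
  rcases hP α hα with h | h
  · have h1 : (F (Order.succ α)).map P.mkQ ≤ (F α).map P.mkQ := by
      refine (Submodule.map_mono h).trans ?_
      rw [Submodule.map_sup, sup_le_iff]
      refine ⟨le_rfl, ?_⟩
      rw [Submodule.mkQ_map_self]
      exact bot_le
    have : Subsingleton (((F (Order.succ α)).map P.mkQ) ⧸
        ((F α).map P.mkQ).submoduleOf ((F (Order.succ α)).map P.mkQ)) :=
      Submodule.Quotient.subsingleton_iff.2 (Submodule.submoduleOf_eq_top.2 h1)
    exact hasContents_of_subsingleton
  · obtain ⟨e⟩ := nonempty_quotient_map_mkQ_equiv (hmono α hα) h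
    obtain ⟨A, hA, ⟨e'⟩⟩ := hA α hα
    exact HasContents.of_linearEquiv ((flatMittagLeffler_iff _).1 hA.1) (e.trans e')

/-- Once the nodes are killed, the relation `branchElt_eq` becomes that of the Bass module, already
inside L/P. -/
lemma mkQ_branchElt_eq {K : Type u} {P : Submodule Rᵐᵒᵖ (TreeModule K a)}
    (hP : ∀ τ, (⟨nodeElt R τ, nodeElt_mem_treeModule a τ⟩ : TreeModule K a) ∈ P) (η : ℕ → K)
    (n : ℕ) : P.mkQ ⟨_, branchElt_mem_treeModule a η 0⟩ =
      MulOpposite.op (chainProd a 0 n) • P.mkQ ⟨_, branchElt_mem_treeModule a η n⟩ := by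
  induction n with
  | zero => simp
  | succ n ih =>
    have h1 : (⟨_, branchElt_mem_treeModule a η n⟩ : TreeModule K a) =
        ⟨_, nodeElt_mem_treeModule a (initSeg η n)⟩ +
          MulOpposite.op (a n) • ⟨_, branchElt_mem_treeModule a η (n + 1)⟩ :=
      Subtype.ext (branchElt_eq a η n)
    have h2 : P.mkQ ⟨_, nodeElt_mem_treeModule a (initSeg η n)⟩ = 0 :=
      (Submodule.Quotient.mk_eq_zero P).2 (hP _)
    rw [ih, h1, map_add, h2, zero_add, map_smul, smul_smul,
      chainProd_succ_right a (Nat.zero_le n), MulOpposite.op_mul]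

open Cardinal in
theorem isStationary_of_isDeconstructible (h : IsDeconstructible (flatMittagLeffler R)) :
    IsStationary a := by
  obtain ⟨κ, hκ⟩ := exists_small_submodule_hasContents_quotient h
  obtain ⟨K, hA, hK, hpow⟩ := exists_large_type (R ⊕ κ.out)
  rw [mk_sum, lift_id, lift_id, mk_out] at hA
  have hnodes : #(Set.range fun τ : Σ n : ℕ, (Fin n → K) =>
      (⟨nodeElt R τ, nodeElt_mem_treeModule a τ⟩ : TreeModule K a)) ≤ #K :=
    mk_range_le.trans (mk_tree_le hK)
  obtain ⟨P, hXP, hPc, hP⟩ := hκ (TreeModule K a) (isLocallyProjective_treeModule a).hasContents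
    #K hK (le_add_self.trans hA) (le_self_add.trans hA) _ hnodes
  -- Each of the at most |K| elements of P has a nonzero projection along finitely many branches
  -- only, and there are at least 2^|K| branches.
  obtain ⟨η, hη⟩ : ∃ η, η ∉ ⋃ x ∈ (P : Set (TreeModule K a)), {η | branchProj a η x ≠ 0} := by
    by_contra! hall
    have h1 := mk_biUnion_le_of_le hK hPc (f := fun x => {η | branchProj a η x ≠ 0})
      fun x _ => (finite_branchProj_ne_zero a x).lt_aleph0.le.trans hK
    rw [Set.eq_univ_of_forall hall, mk_univ] at h1
    exact absurd (hpow.trans h1) (not_le.2 (cantor _))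
  have hPη : P ≤ LinearMap.ker (branchProj a η) := fun x hx => by
    by_contra hne
    exact hη (Set.mem_iUnion₂.2 ⟨x, hx, hne⟩)
  exact isStationary_of_hasContents hP (P.liftQ (branchProj a η) hPη)
    (P.mkQ ⟨_, branchElt_mem_treeModule a η 0⟩) (branchProj_branchElt a η 0)
    fun n => ⟨_, mkQ_branchElt_eq a (fun τ => hXP ⟨τ, rfl⟩) η n⟩

end Deconstruction

end FlatML

namespace FlatML

/-! ### Stationary products and zero radical give semisimplicity -/

section ChainConditionSemisimple

variable {A : Type u} [Ring A]

/-- In a strictly descending chain of principal left ideals the generators satisfy f (n+1) = a n * f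
n, and stationarity for this a contradicts strictness. -/
lemma wellFounded_span_singleton (h : ∀ a : ℕ → A, IsStationary a) :
    WellFounded fun x y : A => Ideal.span {x} < Ideal.span {y} := by
  rw [wellFounded_iff_isEmpty_descending_chain]
  refine ⟨fun ⟨f, hf⟩ => ?_⟩
  have hdiv : ∀ n, ∃ c, c * f n = f (n + 1) := fun n =>
    Ideal.mem_span_singleton'.1 ((hf n).le (Ideal.mem_span_singleton_self _))
  choose a ha using hdiv
  have hprod : ∀ n, chainProd a 0 n * f 0 = f n := by
    intro n
    induction n with
    | zero => simp
    | succ n ih => rw [chainProd_succ_right a (Nat.zero_le n), mul_assoc, ih, ha]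
  obtain ⟨l, hl⟩ := h a
  obtain ⟨c, hc⟩ := hl (l + 1)
  refine (hf l).not_ge ((Ideal.span_singleton_le_iff_mem _).2 (Ideal.mem_span_singleton'.2 ⟨c, ?_⟩))
  rw [← hprod (l + 1), ← hprod l, hc, mul_assoc]

lemma exists_atom_le (h : ∀ a : ℕ → A, IsStationary a) {I : Ideal A} (hI : I ≠ ⊥) :
    ∃ K : Ideal A, IsAtom K ∧ K ≤ I := by
  obtain ⟨x₀, hx₀, hx₀'⟩ := (Submodule.ne_bot_iff I).1 hI
  obtain ⟨x, ⟨hxI, hx⟩, hmin⟩ := (wellFounded_span_singleton h).has_min {x | x ∈ I ∧ x ≠ 0}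
    ⟨x₀, hx₀, hx₀'⟩
  refine ⟨Ideal.span {x}, ⟨fun hb => hx (Ideal.span_singleton_eq_bot.1 hb), fun K hK => ?_⟩,
    (Ideal.span_singleton_le_iff_mem I).2 hxI⟩
  by_contra hne
  obtain ⟨y, hy, hy'⟩ := (Submodule.ne_bot_iff K).1 hne
  have hyx := ((Ideal.span_singleton_le_iff_mem K).2 hy).trans_lt hK
  exact hmin y ⟨
    (Ideal.span_singleton_le_iff_mem I).2 hxI (hyx.le (Ideal.mem_span_singleton_self y)),
    hy'⟩ hyx

/-- As the radical is zero, some maximal left ideal misses the minimal left ideal K, and it is then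
a complement. -/
lemma exists_isCompl_of_isAtom (hJ : Ring.jacobson A = ⊥) {K : Ideal A} (hK : IsAtom K) :
    ∃ m : Ideal A, IsCompl K m := by
  have : ∃ m : Ideal A, m.IsMaximal ∧ ¬ K ≤ m := by
    by_contra! hall
    refine hK.1 (le_bot_iff.1 ?_)
    rw [← hJ, Ring.jacobson_eq_sInf_isMaximal]
    exact le_sInf hall
  obtain ⟨m, hm, hKm⟩ := this
  refine ⟨m, hK.not_le_iff_disjoint.1 hKm, codisjoint_iff.2 ?_⟩
  exact (Ideal.isMaximal_def.1 hm).2 _ (lt_of_le_of_ne le_sup_right fun he => hKm (by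
    rw [he]; exact le_sup_left))

lemma exists_eq_span_singleton_of_isCompl {P Q : Ideal A} (h : IsCompl P Q) :
    ∃ p, P = Ideal.span {p} := by
  have h1 : (1 : A) ∈ P ⊔ Q := by rw [h.sup_eq_top]; trivial
  obtain ⟨p, hp, q, hq, hpq⟩ := Submodule.mem_sup.1 h1
  refine ⟨p, le_antisymm (fun x hx => Ideal.mem_span_singleton'.2 ⟨x, ?_⟩)
    ((Ideal.span_singleton_le_iff_mem P).2 hp)⟩
  have h2 : x * q = x - x * p := by rw [eq_sub_iff_add_eq, ← mul_add, add_comm, hpq, mul_one]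
  have h3 : x * q ∈ P ⊓ Q := ⟨by rw [h2]; exact sub_mem hx (P.mul_mem_left x hp),
    Q.mul_mem_left x hq⟩
  rw [h.inf_eq_bot, Submodule.mem_bot, h2, sub_eq_zero] at h3
  exact h3.symm

theorem isSemisimpleRing_of_isStationary (h : ∀ a : ℕ → A, IsStationary a)
    (hJ : Ring.jacobson A = ⊥) : IsSemisimpleRing A := by
  -- Take A y minimal among principal left ideals with a semisimple complement Q. If it is nonzero,
  -- a minimal left ideal splits off and joins Q, contradicting minimality.
  obtain ⟨y, ⟨Q, hQ, hc⟩, hmin⟩ := (wellFounded_span_singleton h).has_min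
    {y | ∃ Q : Ideal A, IsSemisimpleModule A Q ∧ IsCompl (Ideal.span {y}) Q}
    ⟨1, ⊥, { exists_isCompl := fun x =>
      ⟨⊥, by rw [Subsingleton.elim x ⊤]; exact isCompl_top_bot⟩ },
      by rw [Ideal.span_singleton_one]; exact isCompl_top_bot⟩
  have hy : Ideal.span {y} = ⊥ := by
    by_contra hne
    obtain ⟨K, hK, hKy⟩ := exists_atom_le h hne
    obtain ⟨m, hm⟩ := exists_isCompl_of_isAtom hJ hK
    set L := Ideal.span {y} ⊓ m with hL
    have hKL : K ⊔ L = Ideal.span {y} := by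
      rw [hL, inf_comm, ← sup_inf_assoc_of_le m hKy, hm.sup_eq_top, top_inf_eq]
    have hdisj : K ⊓ L = ⊥ := le_bot_iff.1 ((inf_le_inf_left K inf_le_right).trans hm.inf_eq_bot.le)
    have hLc : IsCompl L (K ⊔ Q) := by
      refine ⟨disjoint_iff.2 (le_bot_iff.1 ?_), codisjoint_iff.2 ?_⟩
      · intro x ⟨hxL, hx⟩
        obtain ⟨k, hk, q, hq, rfl⟩ := Submodule.mem_sup.1 hx
        have hq' : q ∈ Ideal.span {y} ⊓ Q := by
          refine ⟨?_, hq⟩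
          have := sub_mem hxL.1 (hKy hk)
          rwa [add_sub_cancel_left] at this
        rw [hc.inf_eq_bot, Submodule.mem_bot] at hq'
        rw [← hdisj]
        exact ⟨by rw [hq', add_zero]; exact hk, hxL⟩
      · rw [← sup_assoc, sup_comm L K, hKL, hc.sup_eq_top]
    -- The remainder L has a complement, so it is principal and competes in the minimality of A y.
    obtain ⟨p, hp⟩ := exists_eq_span_singleton_of_isCompl hLc
    have hKs : IsSimpleModule A K := isSimpleModule_iff_isAtom.2 hK
    refine hmin p ⟨K ⊔ Q, IsSemisimpleModule.sup inferInstance hQ, hp ▸ hLc⟩ ?_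
    rw [← hp]
    refine lt_of_le_of_ne inf_le_left fun he => hK.1 ?_
    rw [← hdisj, he, inf_eq_left.2 hKy]
  rw [hy] at hc
  have hQt : Q = ⊤ := by simpa using hc.sup_eq_top
  subst hQt
  exact (LinearEquiv.isSemisimpleModule_iff Submodule.topEquiv).1 hQ

end ChainConditionSemisimple

/-! ### Semisimplicity modulo the radical, and T-nilpotence -/

section JacobsonRadical

variable {R : Type u} [Ring R]

lemma IsStationary.map {A : Type u} [Ring A] (f : R →+* A) {a : ℕ → R} (h : IsStationary a) :
    IsStationary fun n => f (a n) := by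
  have hp : ∀ n, chainProd (fun n => f (a n)) 0 n = f (chainProd a 0 n) := by
    intro n
    induction n with
    | zero => simp
    | succ n ih =>
      rw [chainProd_succ_right _ (Nat.zero_le n), chainProd_succ_right _ (Nat.zero_le n), ih,
        map_mul]
  obtain ⟨l, hl⟩ := h
  refine ⟨l, fun n => ?_⟩
  obtain ⟨c, hc⟩ := hl n
  exact ⟨f c, by rw [hp, hp, hc, map_mul]⟩

lemma isSemisimpleRing_quotient_jacobson (h : ∀ a : ℕ → R, IsStationary a) :
    IsSemisimpleRing (R ⧸ Ring.jacobson R) := by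
  refine isSemisimpleRing_of_isStationary (fun b => ?_) ?_
  · obtain ⟨a, rfl⟩ : ∃ a : ℕ → R, (fun n => Ideal.Quotient.mk (Ring.jacobson R) (a n)) = b :=
      ⟨fun n => (Ideal.Quotient.mk_surjective (b n)).choose,
        funext fun n => (Ideal.Quotient.mk_surjective (b n)).choose_spec⟩
    exact (h a).map _
  · exact Ring.jacobson_quotient_jacobson R

lemma exists_mul_one_sub_eq_one {j : R} (hj : j ∈ Ring.jacobson R) : ∃ z, z * (1 - j) = 1 := by
  have : Ideal.span {1 - j} = ⊤ := by
    by_contra hne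
    obtain ⟨m, hm, hle⟩ := Ideal.exists_le_maximal _ hne
    have h1 := Ring.jacobson_le_of_isMaximal m hj
    have h2 := add_mem (hle (Ideal.mem_span_singleton_self _)) h1
    rw [sub_add_cancel] at h2
    exact hm.ne_top ((Ideal.eq_top_iff_one m).2 h2)
  exact Ideal.mem_span_singleton'.1 (this ▸ Submodule.mem_top)

/-- At the stationary stage the product p satisfies p = (c * a l) * p with c * a l in the radical; 1
- c * a l has a left inverse, so p = 0. -/
lemma exists_chainProd_eq_zero {a : ℕ → R} (h : IsStationary a) (ha : ∀ n, a n ∈ Ring.jacobson R) :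
    ∃ n, chainProd a 0 n = 0 := by
  obtain ⟨l, hl⟩ := h
  obtain ⟨c, hc⟩ := hl (l + 1)
  obtain ⟨z, hz⟩ := exists_mul_one_sub_eq_one ((Ring.jacobson R).mul_mem_left c (ha l))
  refine ⟨l, ?_⟩
  rw [chainProd_succ_right a (Nat.zero_le l), ← mul_assoc] at hc
  rw [← one_mul (chainProd a 0 l), ← hz, mul_assoc, sub_mul, one_mul, ← hc, sub_self, mul_zero]

end JacobsonRadical

/-! ### Bass's construction of projective covers -/

section ProjectiveCover

variable {S : Type u} [Ring S]

/-- Left T-nilpotence: each product `s 0 * s 1 * ⋯` of elements of `I` vanishes eventually. -/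
def IsTNilpotent (I : Ideal S) : Prop :=
  ∀ s p : ℕ → S, (∀ n, s n ∈ I) → p 0 = 1 → (∀ n, p (n + 1) = p n * s n) → ∃ n, p n = 0

variable {I : Ideal S}

lemma IsTNilpotent.isNilpotent (h : IsTNilpotent I) {x : S} (hx : x ∈ I) : IsNilpotent x :=
  h (fun _ => x) (fun n => x ^ n) (fun _ => hx) (pow_zero x) (fun n => pow_succ x n)

/-- Nakayama's lemma for arbitrary modules: from x ∉ N, repeatedly expanding modulo N in I • M
produces products p n of elements of I and vectors y n with p n • y n ∉ N, so no p n vanishes. -/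
lemma IsTNilpotent.eq_top (h : IsTNilpotent I) {M : Type u} [AddCommGroup M] [Module S M]
    {N : Submodule S M} (hN : N ⊔ I • (⊤ : Submodule S M) = ⊤) : N = ⊤ := by
  by_contra hne
  obtain ⟨x, -, hx⟩ := SetLike.exists_of_lt (lt_top_iff_ne_top.2 hne)
  have step : ∀ q : {q : S × M // q.1 • q.2 ∉ N}, ∃ s ∈ I, ∃ y, (q.1.1 * s) • y ∉ N := by
    rintro ⟨⟨p, y⟩, hq⟩
    by_contra! hall
    refine hq ?_
    have hy : y ∈ N ⊔ I • (⊤ : Submodule S M) := by rw [hN]; trivial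
    obtain ⟨n, hn, z, hz, rfl⟩ := Submodule.mem_sup.1 hy
    rw [smul_add]
    refine add_mem (N.smul_mem _ hn) ?_
    refine Submodule.smul_induction_on (p := fun z => p • z ∈ N) hz (fun s hs m _ => ?_)
      (fun a b ha hb => ?_)
    · rw [smul_smul]; exact hall s hs m
    · rw [smul_add]; exact add_mem ha hb
  choose s hs y hy using step
  let q : ℕ → {q : S × M // q.1 • q.2 ∉ N} := fun n =>
    Nat.rec ⟨(1, x), by simpa using hx⟩ (fun _ q => ⟨(q.1.1 * s q, y q), hy q⟩) n
  obtain ⟨n, hn⟩ := h (fun n => s (q n)) (fun n => (q n).1.1) (fun n => hs _) rfl (fun n => rfl)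
  apply (q n).2
  rw [hn, zero_smul]
  exact zero_mem _

/-- Generators of a module over `S / I` that exhibit it as a direct sum of modules `T ē` with `ē`
an idempotent of `T = S / I`. -/
lemma exists_idempotent_generators [I.IsTwoSided] (hI : IsTNilpotent I) [IsSemisimpleRing (S ⧸ I)]
    (V : Type u) [AddCommGroup V] [Module (S ⧸ I) V] :
    ∃ (ι : Type u) (e : ι → S) (w : ι → V), (∀ i, IsIdempotentElem (e i)) ∧
      (∀ i, Ideal.Quotient.mk I (e i) • w i = w i) ∧
      Submodule.span (S ⧸ I) (Set.range w) = ⊤ ∧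
      ∀ z : ι →₀ S, (z.sum fun i s => Ideal.Quotient.mk I s • w i) = 0 → ∀ i, z i * e i ∈ I := by
  classical
  obtain ⟨s, eqv, -, hs⟩ := IsSemisimpleModule.exists_linearEquiv_dfinsupp (S ⧸ I) V
  have hW : ∀ i : s, ∃ (e : S) (g : i.1), IsIdempotentElem e ∧ Ideal.Quotient.mk I e • g = g ∧
      (∀ v : i.1, ∃ t : S ⧸ I, v = t • g) ∧ ∀ x : S, Ideal.Quotient.mk I x • g = 0 → x * e ∈ I := by
    intro i
    have := hs i
    obtain ⟨J, ⟨φ⟩⟩ := IsSemisimpleRing.exists_linearEquiv_ideal_of_isSimpleModule (S ⧸ I) i.1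
    obtain ⟨e', he', rfl⟩ := IsSemisimpleRing.ideal_eq_span_idempotent J
    -- Each simple module over S/I is a left ideal generated by an idempotent, which lifts to S
    -- because I is nil.
    obtain ⟨e, he, rfl⟩ := exists_isIdempotentElem_eq_of_ker_isNilpotent (Ideal.Quotient.mk I)
      (fun x hx => hI.isNilpotent (by rwa [Ideal.mk_ker] at hx)) e'
      (Ideal.Quotient.mk_surjective e') he'
    have hmem := Ideal.mem_span_singleton_self (Ideal.Quotient.mk I e)
    refine ⟨e, φ.symm ⟨_, hmem⟩, he, ?_, fun v => ?_, fun x hx => ?_⟩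
    · rw [← map_smul]
      congr 1
      exact Subtype.ext he'
    · obtain ⟨t, ht⟩ := Ideal.mem_span_singleton'.1 (φ v).2
      refine ⟨t, ?_⟩
      rw [← map_smul, LinearEquiv.eq_symm_apply]
      exact Subtype.ext ht.symm
    · rw [← map_smul, LinearEquiv.map_eq_zero_iff] at hx
      rw [← Ideal.Quotient.eq_zero_iff_mem, map_mul]
      exact congrArg Subtype.val hx
  choose e g he heg hgen hann using hW
  refine ⟨s, e, fun i => eqv.symm (DFinsupp.single i (g i)), he, fun i => ?_, ?_, fun z hz i => ?_⟩
  · rw [← map_smul, ← DFinsupp.single_smul, heg]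
  · rw [eq_top_iff]
    rintro v -
    obtain ⟨v, rfl⟩ := eqv.symm.surjective v
    induction v using DFinsupp.induction with
    | h0 => rw [map_zero]; exact zero_mem _
    | ha i b f _ _ ih =>
      rw [map_add]
      refine add_mem ?_ ih
      obtain ⟨t, rfl⟩ := hgen i b
      rw [DFinsupp.single_smul, map_smul]
      exact Submodule.smul_mem _ _ (Submodule.subset_span ⟨i, rfl⟩)
  · apply hann
    have h1 := congrArg eqv hz
    rw [map_finsuppSum, map_zero] at h1
    have h2 := DFunLike.congr_fun h1 i
    simp only [Finsupp.sum, map_smul, LinearEquiv.apply_symm_apply] at h2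
    rw [DFinsupp.finsetSum_apply, Finset.sum_eq_single i] at h2
    · simpa using h2
    · intro j _ hj
      rw [DFinsupp.smul_apply, DFinsupp.single_eq_of_ne (Ne.symm hj), smul_zero]
    · intro hi
      rw [Finsupp.notMem_support_iff.1 hi, map_zero, DFinsupp.smul_apply, zero_smul]

/-- The cover is P = ⨁ S e i, realised as the range of the idempotent endomorphism E, lifting the
decomposition of the semisimple module M/IM. Nakayama is applied twice: it makes the lifted map to M
surjective, and it makes the kernel, which lies in IP, superfluous. -/
theorem exists_isProjectiveCover [I.IsTwoSided] (hI : IsTNilpotent I) [IsSemisimpleRing (S ⧸ I)]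
    (M : Type u) [AddCommGroup M] [Module S M] :
    ∃ (P : ModuleCat.{u} S) (f : P →ₗ[S] M), IsProjectiveCover S f := by
  obtain ⟨ι, e, w, he, hew, hspan, hann⟩ :=
    exists_idempotent_generators hI (M ⧸ I • (⊤ : Submodule S M))
  have hsmul : ∀ (s : S) (v : M ⧸ I • (⊤ : Submodule S M)), Ideal.Quotient.mk I s • v = s • v := by
    intro s v
    obtain ⟨m, rfl⟩ := Submodule.mkQ_surjective _ v
    rfl
  let E : (ι →₀ S) →ₗ[S] (ι →₀ S) :=
    Finsupp.linearCombination S fun i => Finsupp.single i (e i)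
  have hE : ∀ z i, E z i = z i * e i := by
    intro z i
    induction z using Finsupp.induction_linear with
    | zero => simp
    | add z z' h h' => rw [map_add, Finsupp.add_apply, h, h', Finsupp.add_apply, add_mul]
    | single j s =>
      by_cases hij : i = j
      · subst hij; simp [E]
      · simp [E, Finsupp.single_eq_of_ne hij]
  have hEE : ∀ z, E (E z) = E z := fun z => by
    ext i; rw [hE, hE, mul_assoc, (he i).eq]
  let P := LinearMap.range E
  have hPE : ∀ z ∈ P, E z = z := by rintro _ ⟨z, rfl⟩; exact hEE z
  have hproj : Module.Projective S P :=
    Module.Projective.of_split P.subtype E.rangeRestrict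
      (LinearMap.ext fun z => Subtype.ext (hPE z z.2))
  let g : (ι →₀ S) →ₗ[S] (M ⧸ I • (⊤ : Submodule S M)) := Finsupp.linearCombination S w
  have hgE : ∀ z, g (E z) = g z := by
    intro z
    refine LinearMap.congr_fun (f := g ∘ₗ E) (g := g) (Finsupp.lhom_ext' fun i =>
      LinearMap.ext_ring ?_) z
    have h1 := hew i
    rw [hsmul] at h1
    simpa [g, E] using h1
  have hg : Function.Surjective g := by
    rw [← LinearMap.range_eq_top, Finsupp.range_linearCombination, eq_top_iff]
    intro v _
    have hv : v ∈ Submodule.span (S ⧸ I) (Set.range w) := by rw [hspan]; trivial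
    induction hv using Submodule.span_induction with
    | mem v hv => exact Submodule.subset_span hv
    | zero => exact zero_mem _
    | add v v' _ _ h h' => exact add_mem (h trivial) (h' trivial)
    | smul t v _ h =>
      obtain ⟨s, rfl⟩ := Ideal.Quotient.mk_surjective t
      rw [hsmul]
      exact Submodule.smul_mem _ _ (h trivial)
  obtain ⟨f, hf⟩ := Module.projective_lifting_property (I • (⊤ : Submodule S M)).mkQ
    (g ∘ₗ P.subtype) (Submodule.mkQ_surjective _)
  have hf' : ∀ z : P, (I • (⊤ : Submodule S M)).mkQ (f z) = g z := LinearMap.congr_fun hf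
  refine ⟨ModuleCat.of S P, f, hproj, ?_, fun N hN =>
    hI.eq_top (eq_top_iff.2 (hN.ge.trans (sup_le_sup_left ?_ N)))⟩
  · rw [← LinearMap.range_eq_top]
    refine hI.eq_top (eq_top_iff.2 fun m _ => ?_)
    obtain ⟨z, hz⟩ := hg ((I • (⊤ : Submodule S M)).mkQ m)
    have h1 : (I • (⊤ : Submodule S M)).mkQ (f ⟨E z, z, rfl⟩) =
        (I • (⊤ : Submodule S M)).mkQ m := by rw [hf', ← hz]; exact hgE z
    have h2 := (Submodule.Quotient.eq _).1 h1.symm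
    rw [← add_sub_cancel (f ⟨E z, z, rfl⟩) m]
    exact add_mem (Submodule.mem_sup_left ⟨_, rfl⟩) (Submodule.mem_sup_right h2)
  · rintro ⟨z, hz⟩ hzf
    have h1 : g z = 0 := by
      rw [← hf' ⟨z, hz⟩, LinearMap.mem_ker.1 hzf, map_zero]
    have h2 : ∀ i, z i ∈ I := fun i => by
      have := hann z (by simpa [g, Finsupp.linearCombination_apply, hsmul] using h1) i
      rwa [← hE, hPE z hz] at this
    have h3 : (⟨z, hz⟩ : P) =
        ∑ i ∈ z.support, z i • ⟨E (Finsupp.single i 1), _, rfl⟩ := by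
      apply Subtype.ext
      rw [Submodule.coe_sum]
      change z = ∑ i ∈ z.support, z i • E (Finsupp.single i 1)
      simp_rw [← map_smul, ← map_sum, Finsupp.smul_single, smul_eq_mul, mul_one]
      exact (hPE z hz).symm.trans (congrArg E z.sum_single.symm)
    rw [h3]
    exact Submodule.sum_mem _ fun i _ => Submodule.smul_mem_smul (h2 i) trivial

end ProjectiveCover

/-! ### Stationarity for all sequences implies right perfect -/

section RightPerfect

variable {R : Type u} [Ring R]

theorem isRightPerfect_of_isStationary (h : ∀ a : ℕ → R, IsStationary a) : IsRightPerfect R := by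
  have := isSemisimpleRing_quotient_jacobson h
  let π : Rᵐᵒᵖ →+* (R ⧸ Ring.jacobson R)ᵐᵒᵖ := (Ideal.Quotient.mk (Ring.jacobson R)).op
  have hπ : Function.Surjective π := by
    intro x
    obtain ⟨r, hr⟩ := Ideal.Quotient.mk_surjective x.unop
    exact ⟨MulOpposite.op r, MulOpposite.unop_injective hr⟩
  have hker : ∀ x, x ∈ RingHom.ker π ↔ x.unop ∈ Ring.jacobson R := fun x => by
    rw [RingHom.mem_ker, ← Ideal.Quotient.eq_zero_iff_mem, ← MulOpposite.unop_eq_zero_iff]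
    rfl
  -- Semisimplicity is left-right symmetric, so it transfers from R/J to the opposite ring, over
  -- which right modules live.
  have hss : IsSemisimpleRing (Rᵐᵒᵖ ⧸ RingHom.ker π) :=
    (RingHom.quotientKerEquivOfSurjective hπ).symm.isSemisimpleRing
  have hnil : IsTNilpotent (RingHom.ker π) := by
    intro s p hs hp0 hp
    have hprod : ∀ n, p n = MulOpposite.op (chainProd (fun n => (s n).unop) 0 n) := by
      intro n
      induction n with
      | zero => simpa using hp0
      | succ n ih =>
        rw [hp, ih, chainProd_succ_right _ (Nat.zero_le n), MulOpposite.op_mul,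
          MulOpposite.op_unop]
    obtain ⟨n, hn⟩ := exists_chainProd_eq_zero (h fun n => (s n).unop) fun n => (hker _).1 (hs n)
    exact ⟨n, by rw [hprod, hn, MulOpposite.op_zero]⟩
  exact fun M _ _ => exists_isProjectiveCover hnil M

end RightPerfect

end FlatML

namespace FlatML

/-! ### A flat module with a projective cover is projective -/

section FlatCover

variable {R : Type u} [Ring R] {M : Type u} [AddCommGroup M] [Module Rᵐᵒᵖ M]

lemma extend_pUnit_apply {X : Type u} (c : X → Rᵐᵒᵖ) (z : X →₀ M) :
    extend M (Finsupp.linearCombination R fun x =>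
      Finsupp.single PUnit.unit.{u + 1} (c x).unop) z PUnit.unit = z.sum fun x y => c x • y := by
  induction z using Finsupp.induction_linear with
  | zero => simp
  | add z w hz hw =>
    rw [(extend M _).map_add, Finsupp.add_apply, hz, hw,
      Finsupp.sum_add_index' (by simp) fun x a b => smul_add _ a b]
  | single x y => rw [extend_single]; simp

/-- Given k in ker f, flatness provides an endomorphism v of P with image in ker f and v k = k. As
ker f is superfluous, 1 - v is bijective, and it kills k. -/
theorem projective_of_isProjectiveCover {P : Type u} [AddCommGroup P] [Module Rᵐᵒᵖ P]
    {f : P →ₗ[Rᵐᵒᵖ] M} (hf : IsProjectiveCover Rᵐᵒᵖ f)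
    (hM : HasContents (⊤ : Submodule Rᵐᵒᵖ M)) : Module.Projective Rᵐᵒᵖ M := by
  classical
  obtain ⟨hP, hsurj, hsup⟩ := hf
  obtain ⟨σ, hσ⟩ := Module.projective_def'.1 hP
  have hker : LinearMap.ker f = ⊥ := by
    rw [eq_bot_iff]
    intro k hk
    let m : P →₀ M := Finsupp.onFinset (σ k).support
      (fun x => if x ∈ (σ k).support then f x else 0) (fun x hx => by
        by_contra h; simp [h] at hx)
    have hm : ∀ x ∈ (σ k).support, m x = f x := fun x hx => by
      simp only [m, Finsupp.onFinset_apply, if_pos hx]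
    have hm' : ∀ x ∉ (σ k).support, m x = 0 := fun x hx => by
      simp only [m, Finsupp.onFinset_apply, if_neg hx]
    have hσk : ∑ x ∈ (σ k).support, σ k x • x = k := by
      have := LinearMap.congr_fun hσ k
      rwa [LinearMap.comp_apply, Finsupp.linearCombination_apply] at this
    have h0 : extend M (Finsupp.linearCombination R fun x =>
        Finsupp.single PUnit.unit.{u + 1} (σ k x).unop) m = 0 := by
      ext
      rw [extend_pUnit_apply, Finsupp.sum_of_support_subset (s := (σ k).support) _
        (fun x hx => by by_contra h; exact Finsupp.mem_support_iff.1 hx (hm' x h)) _ (by simp)]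
      rw [Finset.sum_congr rfl fun x hx => by rw [hm x hx, ← map_smul], ← map_sum, hσk]
      exact hk
    -- The dual basis expansion k = ∑ σ k x • x maps to a relation among the f x. Flatness allows f
    -- x to be lifted to elements z x of P that satisfy the same relation.
    obtain ⟨z, hz, hzm⟩ := exists_mapCoeff_eq (G := ⊤) f
      (by rw [Submodule.map_top, LinearMap.range_eq_top.2 hsurj]
          exact hM.mem_ker _ (fun _ => trivial) h0)
    have hz0 : ∑ x ∈ (σ k).support, σ k x • z x = 0 := by
      have h1 := DFunLike.congr_fun (extend_eq_zero_of_mem _ hz) PUnit.unit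
      rw [extend_pUnit_apply, Finsupp.sum_of_support_subset (s := (σ k).support ∪ z.support) _
        Finset.subset_union_right _ (by simp), Finsupp.zero_apply] at h1
      rw [← h1]
      refine Finset.sum_subset Finset.subset_union_left fun x _ hx => ?_
      rw [Finsupp.notMem_support_iff.1 hx, zero_smul]
    let v : P →ₗ[Rᵐᵒᵖ] P := (Finsupp.linearCombination Rᵐᵒᵖ fun x =>
      if x ∈ (σ k).support then x - z x else 0) ∘ₗ σ
    have hfv : ∀ x, f (v x) = 0 := by
      intro x
      have : f ∘ₗ (Finsupp.linearCombination Rᵐᵒᵖ fun x =>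
          if x ∈ (σ k).support then x - z x else 0) = 0 := by
        refine Finsupp.lhom_ext' fun x => LinearMap.ext_ring ?_
        by_cases hx : x ∈ (σ k).support
        · have h1 : f (z x) = f x := by
            rw [← hm x hx, ← hzm, mapCoeff_apply]
          simp only [LinearMap.comp_apply, Finsupp.lsingle_apply,
            Finsupp.linearCombination_single, one_smul, if_pos hx, map_sub, h1, sub_self,
            LinearMap.zero_apply]
        · simp only [LinearMap.comp_apply, Finsupp.lsingle_apply,
            Finsupp.linearCombination_single, one_smul, if_neg hx, map_zero, LinearMap.zero_apply]
      exact LinearMap.congr_fun this (σ x)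
    have hvk : v k = k := by
      change Finsupp.linearCombination Rᵐᵒᵖ _ (σ k) = k
      rw [Finsupp.linearCombination_apply, Finsupp.sum, Finset.sum_congr rfl fun x hx => by
        rw [if_pos hx, smul_sub], Finset.sum_sub_distrib, hσk, hz0, sub_zero]
    have hsurj' : Function.Surjective (LinearMap.id - v : P →ₗ[Rᵐᵒᵖ] P) := by
      rw [← LinearMap.range_eq_top]
      refine hsup _ (eq_top_iff.2 fun x _ => ?_)
      rw [← sub_add_cancel x (v x)]
      exact add_mem (Submodule.mem_sup_left ⟨x, rfl⟩) (Submodule.mem_sup_right (hfv x))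
    obtain ⟨t, ht⟩ := Module.projective_lifting_property _ LinearMap.id hsurj'
    have ht' : ∀ x, t x - v (t x) = x := LinearMap.congr_fun ht
    -- Superfluity again: modulo the image of v, the section t of 1 - v is the identity. Being also
    -- onto, t inverts 1 - v, which gives injectivity.
    have hts : LinearMap.range t = ⊤ := by
      refine hsup _ (eq_top_iff.2 fun x _ => ?_)
      rw [← add_sub_cancel (t (x - v x)) x]
      refine add_mem (Submodule.mem_sup_left ⟨_, rfl⟩) (Submodule.mem_sup_right ?_)
      have h1 : x - t (x - v x) = v (x - t (x - v x)) := by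
        rw [map_sub v, ← sub_eq_zero]
        have := ht' (x - v x)
        rw [← sub_eq_zero] at this
        rw [← neg_eq_zero, ← this]
        abel
      rw [LinearMap.mem_ker, h1, hfv]
    obtain ⟨y, hy⟩ := LinearMap.range_eq_top.1 hts k
    have h2 := ht' y
    rw [hy, hvk, sub_self] at h2
    rw [Submodule.mem_bot, ← hy, ← h2, map_zero]
  exact Module.Projective.of_equiv
    (LinearEquiv.ofBijective f ⟨LinearMap.ker_eq_bot.1 hker, hsurj⟩)

end FlatCover

/-! ### Filtering projective modules by countably presented ones -/

section Kaplansky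

variable {S : Type u} [Ring S] {M : Type u} [AddCommGroup M] [Module S M]

/-- The kernel of p is the image of 1 - i p, so it is generated by the images of the countably many
basis vectors. -/
lemma isLTPresented_of_retract {D : Type u} [Countable D] {i : M →ₗ[S] (D →₀ S)}
    {p : (D →₀ S) →ₗ[S] M} (h : ∀ x, p (i x) = x) :
    IsLTPresented (S := S) (Cardinal.aleph 1) M := by
  have hlt : ∀ Y : Type u, Countable Y → Cardinal.mk Y < Cardinal.aleph 1 := fun Y _ =>
    (Cardinal.mk_le_aleph0 (α := Y)).trans_lt Cardinal.aleph0_lt_aleph_one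
  refine ⟨D, p, Set.range fun d => Finsupp.single d 1 - i (p (Finsupp.single d 1)), hlt _ ‹_›,
    fun x => ⟨i x, h x⟩, hlt _ (Set.countable_range _).to_subtype, le_antisymm ?_ ?_⟩
  · rw [Submodule.span_le]
    rintro _ ⟨d, rfl⟩
    simp [h]
  · intro z hz
    have h1 : z = (LinearMap.id - i ∘ₗ p : (D →₀ S) →ₗ[S] (D →₀ S)) z := by
      rw [LinearMap.sub_apply, LinearMap.comp_apply, LinearMap.mem_ker.1 hz, map_zero, sub_zero]
      rfl
    have h2 : LinearMap.id - i ∘ₗ p = Finsupp.linearCombination S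
        fun d => Finsupp.single d (1 : S) - i (p (Finsupp.single d 1)) := by
      refine Finsupp.lhom_ext' fun d => LinearMap.ext_ring ?_
      simp
    rw [h1, h2, ← Finsupp.range_linearCombination]
    exact ⟨z, rfl⟩

/-- The elements of `M` whose image under `σ` is supported in `C`. -/
noncomputable def supportedPart {X : Type u} (σ : M →ₗ[S] (X →₀ S)) (C : Set X) : Submodule S M :=
  (Finsupp.supported S S C).comap σ

variable {X : Type u} {σ : M →ₗ[S] (X →₀ S)} {π : (X →₀ S) →ₗ[S] M}

lemma mem_supportedPart {C : Set X} {x : M} :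
    x ∈ supportedPart σ C ↔ ∀ d ∉ C, σ x d = 0 := Finsupp.mem_supported' S _

lemma supportedPart_mono {C C' : Set X} (h : C ⊆ C') : supportedPart σ C ≤ supportedPart σ C' :=
  Submodule.comap_mono (Finsupp.supported_mono h)

/-- Closed sets of basis elements with respect to the endomorphism `σ ∘ π` of the free module. -/
def IsClosedFor (σ : M →ₗ[S] (X →₀ S)) (π : (X →₀ S) →ₗ[S] M) (C : Set X) : Prop :=
  ∀ x ∈ C, π (Finsupp.single x 1) ∈ supportedPart σ C

lemma IsClosedFor.apply_mem {C : Set X} (hC : IsClosedFor σ π C) {z : X →₀ S}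
    (hz : z ∈ Finsupp.supported S S C) : π z ∈ supportedPart σ C := by
  rw [← z.sum_single, Finsupp.sum, map_sum]
  refine Submodule.sum_mem _ fun x hx => ?_
  have : Finsupp.single x (z x) = z x • Finsupp.single x (1 : S) := by simp
  rw [this, map_smul]
  exact Submodule.smul_mem _ _ (hC x (hz hx))

lemma IsClosedFor.iUnion {ι : Sort*} {C : ι → Set X} (hC : ∀ i, IsClosedFor σ π (C i)) :
    IsClosedFor σ π (⋃ i, C i) := by
  intro x hx
  obtain ⟨i, hi⟩ := Set.mem_iUnion.1 hx
  exact supportedPart_mono (Set.subset_iUnion C i) (hC i x hi)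

lemma exists_countable_isClosedFor (σ : M →ₗ[S] (X →₀ S)) (π : (X →₀ S) →ₗ[S] M) (x : X) :
    ∃ C : Set X, x ∈ C ∧ C.Countable ∧ IsClosedFor σ π C := by
  let next : Set X → Set X := fun T => ⋃ y ∈ T, ((σ (π (Finsupp.single y 1))).support : Set X)
  refine ⟨⋃ n : ℕ, next^[n] {x}, Set.mem_iUnion.2 ⟨0, rfl⟩, Set.countable_iUnion fun n => ?_, ?_⟩
  · induction n with
    | zero => exact Set.countable_singleton x
    | succ n ih =>
      rw [Function.iterate_succ_apply']
      exact ih.biUnion fun y _ => Finset.countable_toSet _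
  · intro y hy
    obtain ⟨n, hn⟩ := Set.mem_iUnion.1 hy
    refine (Finsupp.mem_supported S _).2 fun d hd => Set.mem_iUnion.2 ⟨n + 1, ?_⟩
    rw [Function.iterate_succ_apply']
    exact Set.mem_iUnion₂.2 ⟨y, hn, hd⟩

/-- Keep only the coordinates of σ x in C' \ C, then apply π: the discarded coordinates lie in C,
and since C is closed they change the result by an element of the smaller part. -/
lemma exists_retract_quotient (hπσ : ∀ x, π (σ x) = x) {C C' : Set X} (hC : IsClosedFor σ π C)
    (hC' : IsClosedFor σ π C') :
    ∃ (i : (supportedPart σ C' ⧸ (supportedPart σ C).submoduleOf (supportedPart σ C')) →ₗ[S]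
        ((C' \ C : Set X) →₀ S))
      (p : ((C' \ C : Set X) →₀ S) →ₗ[S]
        (supportedPart σ C' ⧸ (supportedPart σ C).submoduleOf (supportedPart σ C'))),
      ∀ x, p (i x) = x := by
  let D : Set X := C' \ C
  let incl : (D →₀ S) →ₗ[S] (X →₀ S) := Finsupp.lmapDomain S S Subtype.val
  have hincl : ∀ z, incl z ∈ Finsupp.supported S S C' := fun z => by
    refine (Finsupp.mem_supported' S _).2 fun d hd => Finsupp.mapDomain_of_notMem_range _ _ ?_
    rintro ⟨d, rfl⟩
    exact hd d.2.1
  let res : supportedPart σ C' →ₗ[S] (D →₀ S) :=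
    (Finsupp.lcomapDomain (Subtype.val : D → X) Subtype.val_injective) ∘ₗ σ ∘ₗ
      (supportedPart σ C').subtype
  have hres : ∀ (x : supportedPart σ C') (d : D), res x d = σ x d := fun _ _ => rfl
  have hker : (supportedPart σ C).submoduleOf (supportedPart σ C') ≤ LinearMap.ker res := by
    intro x hx
    refine LinearMap.mem_ker.2 (Finsupp.ext fun d => ?_)
    rw [hres]
    exact mem_supportedPart.1 hx d d.2.2
  refine ⟨Submodule.liftQ _ res hker, Submodule.mkQ _ ∘ₗ
    (π ∘ₗ incl).codRestrict (supportedPart σ C') fun z => hC'.apply_mem (hincl z), fun x => ?_⟩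
  obtain ⟨x, rfl⟩ := Submodule.mkQ_surjective _ x
  refine (Submodule.Quotient.eq _).2 ?_
  change π (incl (res x)) - x.1 ∈ supportedPart σ C
  rw [← hπσ x.1, ← map_sub]
  refine hC.apply_mem ((Finsupp.mem_supported' S _).2 fun d hd => ?_)
  rw [Finsupp.sub_apply, sub_eq_zero]
  by_cases hd' : d ∈ C'
  · have := Finsupp.mapDomain_apply (M := S) (Subtype.val_injective (p := (· ∈ D))) (res x)
      ⟨d, hd', hd⟩
    exact this
  · rw [mem_supportedPart.1 x.2 d hd']
    exact (Finsupp.mem_supported' S _).1 (hincl _) d hd'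

/-- The union of the chosen sets of index below `α`. -/
def chainSet (cl : X → Set X) (rank : X → Ordinal.{u}) (α : Ordinal.{u}) : Set X :=
  ⋃ x : {x // rank x < α}, cl x

lemma chainSet_mono (cl : X → Set X) (rank : X → Ordinal.{u}) {α β : Ordinal.{u}} (h : α ≤ β) :
    chainSet cl rank α ⊆ chainSet cl rank β :=
  Set.iUnion_subset fun x => Set.subset_iUnion_of_subset ⟨x, x.2.trans_le h⟩ subset_rfl

/-- Kaplansky's theorem, in filtered form. -/
theorem isTransfiniteExtension_of_projective (𝒜 : ObjectProperty (ModuleCat.{u} S))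
    (h𝒜 : ∀ N : ModuleCat.{u} S, Module.Projective S N → 𝒜 N) [Module.Projective S M] :
    IsTransfiniteExtension (ltPresented 𝒜 (Cardinal.aleph 1)) M := by
  classical
  obtain ⟨σ, hσ⟩ := Module.projective_def'.1 ‹Module.Projective S M›
  set π : (M →₀ S) →ₗ[S] M := Finsupp.linearCombination S id
  have hπσ : ∀ x, π (σ x) = x := LinearMap.congr_fun hσ
  choose cl hmem hcount hclosed using exists_countable_isClosedFor σ π
  let rank : M → Ordinal.{u} := Ordinal.typein (WellOrderingRel (α := M))
  have hrank : Function.Injective rank := Ordinal.typein_injective _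
  have hC : ∀ α, IsClosedFor σ π (chainSet cl rank α) := fun α =>
    IsClosedFor.iUnion fun x => hclosed x
  refine ⟨Ordinal.type (WellOrderingRel (α := M)), fun α => supportedPart σ (chainSet cl rank α),
    ⟨?_, ?_, fun α β h _ => ?_, fun α _ hα => ?_⟩, fun α _ => ?_⟩
  · rw [eq_bot_iff]
    intro x hx
    have : σ x = 0 := Finsupp.ext fun d => mem_supportedPart.1 hx d fun hd => by
      obtain ⟨y, -⟩ := Set.mem_iUnion.1 hd
      exact not_lt_zero y.2
    rw [Submodule.mem_bot, ← hπσ x, this, map_zero]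
  · rw [eq_top_iff]
    intro x _
    refine mem_supportedPart.2 fun d hd => (hd ?_).elim
    exact Set.mem_iUnion.2 ⟨⟨d, Ordinal.typein_lt_type _ d⟩, hmem d⟩
  · exact supportedPart_mono (chainSet_mono cl rank h)
  · refine subset_antisymm (fun x hx => ?_) (Set.iUnion₂_subset fun β hβ x hx =>
      supportedPart_mono (chainSet_mono cl rank hβ.le) hx)
    have key : ∀ s : Finset M, (∀ d ∈ s, d ∈ chainSet cl rank α) →
        ∃ β < α, ∀ d ∈ s, d ∈ chainSet cl rank β := by
      intro s
      induction s using Finset.induction_on with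
      | empty => exact fun _ => ⟨0, hα.bot_lt, by simp⟩
      | insert a s _ ih =>
        intro hs
        obtain ⟨β, hβ, h⟩ := ih fun d hd => hs d (Finset.mem_insert_of_mem hd)
        obtain ⟨⟨y, hy⟩, hay⟩ := Set.mem_iUnion.1 (hs a (Finset.mem_insert_self a s))
        refine ⟨max β (Order.succ (rank y)), max_lt hβ (hα.succ_lt hy), fun d hd => ?_⟩
        rcases Finset.mem_insert.1 hd with rfl | hd
        · exact Set.mem_iUnion.2 ⟨⟨y, (Order.lt_succ _).trans_le (le_max_right _ _)⟩, hay⟩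
        · exact chainSet_mono cl rank (le_max_left _ _) (h d hd)
    obtain ⟨β, hβ, h⟩ := key (σ x).support fun d hd => hx hd
    exact Set.mem_iUnion₂.2 ⟨β, hβ, (Finsupp.mem_supported S _).2 h⟩
  · obtain ⟨i, p, hpi⟩ := exists_retract_quotient hπσ (hC α) (hC (Order.succ α))
    -- The set added at stage α lies in the countable closure of the one element of rank α, or is
    -- empty if there is none.
    have hcountable : Countable
        (chainSet cl rank (Order.succ α) \ chainSet cl rank α : Set M) := by
      by_cases hx : ∃ x, rank x = α
      · obtain ⟨x, rfl⟩ := hx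
        refine ((hcount x).mono fun d hd => ?_).to_subtype
        obtain ⟨⟨y, hy⟩, hdy⟩ := Set.mem_iUnion.1 hd.1
        rcases (Order.lt_succ_iff.1 hy).eq_or_lt with h | h
        · rwa [← hrank h]
        · exact (hd.2 (Set.mem_iUnion.2 ⟨⟨y, h⟩, hdy⟩)).elim
      · refine (Set.countable_empty.mono fun d hd => hd.2 ?_).to_subtype
        obtain ⟨⟨y, hy⟩, hdy⟩ := Set.mem_iUnion.1 hd.1
        exact Set.mem_iUnion.2 ⟨⟨y, (Order.lt_succ_iff.1 hy).lt_of_ne fun h => hx ⟨y, h⟩⟩, hdy⟩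
    exact ⟨ModuleCat.of S _, ⟨h𝒜 _ (Module.Projective.of_split i p (LinearMap.ext hpi)),
      isLTPresented_of_retract hpi⟩, ⟨LinearEquiv.refl _ _⟩⟩

end Kaplansky

theorem isDeconstructible_of_isRightPerfect {R : Type u} [Ring R] (h : IsRightPerfect R) :
    IsDeconstructible (flatMittagLeffler R) := by
  refine ⟨Cardinal.aleph 1, Cardinal.aleph0_le_aleph 1, fun M hM => ?_⟩
  obtain ⟨P, f, hf⟩ := h M
  have := projective_of_isProjectiveCover hf ((flatMittagLeffler_iff M).1 hM)
  exact isTransfiniteExtension_of_projective _ fun N hN =>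
    (flatMittagLeffler_iff N).2 (isLocallyProjective_of_projective (R := R)).hasContents

end FlatML

theorem mainTheorem3 (R : Type u) [Ring R] :
    (FlatML.IsDeconstructible (FlatML.flatMittagLeffler R) ↔ FlatML.IsRightPerfect R) ∧
    (¬ FlatML.IsRightPerfect R →
      ¬ ∃ ℬ : CategoryTheory.ObjectProperty (ModuleCat.{u} Rᵐᵒᵖ),
        FlatML.IsCotorsionPair (FlatML.flatMittagLeffler R) ℬ ∧ FlatML.IsPerpOfSet ℬ) := by
  refine ⟨⟨fun h => ?_, FlatML.isDeconstructible_of_isRightPerfect⟩, fun h ⟨ℬ, hℬ, _⟩ => h ?_⟩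
  · exact FlatML.isRightPerfect_of_isStationary fun a =>
      FlatML.isStationary_of_isDeconstructible a h
  · exact FlatML.isRightPerfect_of_isStationary fun a => FlatML.isStationary_of_isCotorsionPair a hℬ
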